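/- Let $p$, $q$ and $r$ be distinct odd primes, and let $G$ be a group isomorphic to $D_{2pq} \times \mathbb{Z}_r$, where $D_{2pq}$ is the dihedral group of order $2pq$ and $\mathbb{Z}_r$ is the cyclic group of order $r$. For a subset $S$ of $G$, let $\mathrm{Cay}(G;S)$ be the Cayley graph whose vertices are the elements of $G$, with an edge joining $g$ to $gs$ for every $g \in G$ and $s \in S$ (loops are disregarded). If $\mathrm{Cay}(G;S)$ is connected, then it has a hamiltonian cycle. -/

import Mathlib

/-! ### Words and hamiltonian cycles in Cayley graphs -/

/-! A hamiltonian cycle is encoded as a word of length `Nat.card G` with product `1` whose partial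
products exhaust the group (`IsHamWord`); the length then forces every vertex to occur exactly once.
Elements get coordinates in `DihZ`: a rotation or reflection, with entries modulo `p`, `q` and `r`.

The main tool is the factor group lemma. If a word traces a hamiltonian cycle modulo the central
subgroup of order `r` and its product is a nontrivial element of that subgroup, then its `r`-fold
repetition is a hamiltonian cycle (`IsCycleModR.exists_isHamWord`). The work is to find such a word
with nontrivial product.

Suppose first that some reflection in `S` has nonzero `r`-coordinate `c`, or that `S` contains a
nontrivial central rotation. A reflection and its inverse differ only in the sign of `c`, so
exchanging one for the other keeps the cycle in the quotient but changes the product; one of the two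
products is nontrivial. If `S` has a central rotation instead, a trivial product is harmless,
because the cycle can snake through the `r` layers. Suitable quotient cycles come from
connectedness, which supplies letters moving the `p`-coordinate and the `q`-coordinate
(`exists_isHamWord_of_ne_zero`).

Otherwise all reflections have `r`-coordinate `0`, and connectedness gives a noncentral rotation
with nonzero `r`-coordinate. If it has order `pqr`, then together with a reflection it spans a
generalized Petersen graph with `k ^ 2 = 1` modulo `n = pqr`, which has an explicit hamiltonian
cycle (`trail_of_mul_self_modEq_one`). If not, it has order `pr` or `qr`; several candidate words
are written down, and arithmetic shows that they cannot all have trivial product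
(`exists_isHamWord_of_rot`). -/

section Words

/-- The `m`-fold repetition of a word. -/
def wordPow {α : Type*} (w : List α) : ℕ → List α
  | 0 => []
  | m + 1 => w ++ wordPow w m

@[simp] lemma length_wordPow {α : Type*} (w : List α) (m : ℕ) : (wordPow w m).length = m * w.length := by
  induction m with
  | zero => simp [wordPow]
  | succ m ih => simp [wordPow, ih]; ring

lemma mem_wordPow {α : Type*} {w : List α} {m : ℕ} {s : α} (h : s ∈ wordPow w m) : s ∈ w := by
  induction m with
  | zero => simp [wordPow] at h
  | succ m ih =>
    rcases List.mem_append.1 h with h | h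
    exacts [h, ih h]

variable {G : Type*} [Group G]

/-- `x` is a partial product of the word `w`. -/
def Visits (w : List G) (x : G) : Prop := ∃ u v, w = u ++ v ∧ u.prod = x

lemma Visits.one (w : List G) : Visits w 1 := ⟨[], w, rfl, rfl⟩

lemma Visits.prod (w : List G) : Visits w w.prod := ⟨w, [], by simp, rfl⟩

lemma Visits.append_right {u : List G} {x : G} (h : Visits u x) (v : List G) :
    Visits (u ++ v) x := by
  obtain ⟨a, b, rfl, rfl⟩ := h
  exact ⟨a, b ++ v, by simp, rfl⟩

lemma Visits.append_left {v : List G} {x : G} (u : List G) (h : Visits v x) :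
    Visits (u ++ v) (u.prod * x) := by
  obtain ⟨a, b, rfl, rfl⟩ := h
  exact ⟨u ++ a, b, by simp, by simp⟩

lemma Visits.cons {v : List G} {x : G} (s : G) (h : Visits v x) : Visits (s :: v) (s * x) := by
  simpa using h.append_left [s]

lemma visits_replicate {m i : ℕ} (t : G) (h : i ≤ m) : Visits (List.replicate m t) (t ^ i) :=
  ⟨List.replicate i t, List.replicate (m - i) t,
    by rw [← List.replicate_add]; congr; omega, by simp⟩

@[simp] lemma prod_wordPow (w : List G) (m : ℕ) : (wordPow w m).prod = w.prod ^ m := by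
  induction m with
  | zero => simp [wordPow]
  | succ m ih => simp [wordPow, ih, pow_succ']

lemma Visits.wordPow {w : List G} {x : G} (h : Visits w x) {m j : ℕ} (hj : j < m) :
    Visits (wordPow w m) (w.prod ^ j * x) := by
  induction m generalizing j with
  | zero => omega
  | succ m ih =>
    cases j with
    | zero => rw [pow_zero, one_mul]; exact h.append_right _
    | succ j =>
      have := (ih (by omega : j < m)).append_left w
      rwa [← mul_assoc, ← pow_succ'] at this

/-- The nontrivial elements of `S` and their inverses. -/
def IsLetter (S : Set G) (s : G) : Prop := s ≠ 1 ∧ (s ∈ S ∨ s⁻¹ ∈ S)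

lemma IsLetter.inv {S : Set G} {s : G} (h : IsLetter S s) : IsLetter S s⁻¹ :=
  ⟨by simpa using h.1, by simpa using h.2.symm⟩

/-- A word in the letters of `S` that traces a hamiltonian cycle. -/
structure IsHamWord (S : Set G) (w : List G) : Prop where
  letter : ∀ s ∈ w, IsLetter S s
  prod_eq_one : w.prod = 1
  visits : ∀ g, Visits w g
  length_eq : w.length = Nat.card G

lemma IsHamWord.map {H : Type*} [Group H] (e : G ≃* H) {S : Set H} {w : List G}
    (h : IsHamWord (e ⁻¹' S) w) : IsHamWord S (w.map e) where
  letter s hs := by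
    obtain ⟨t, ht, rfl⟩ := List.mem_map.1 hs
    obtain ⟨h1, h2⟩ := h.letter t ht
    exact ⟨by simpa using h1, by simpa using h2⟩
  prod_eq_one := by rw [← map_list_prod, h.prod_eq_one, map_one]
  visits g := by
    obtain ⟨u, v, huv, hu⟩ := h.visits (e.symm g)
    exact ⟨u.map e, v.map e, by simp [huv], by rw [← map_list_prod, hu]; simp⟩
  length_eq := by rw [List.length_map, h.length_eq, Nat.card_congr e.toEquiv]

lemma exists_walk_of_word {S : Set G} (w : List G) (hw : ∀ s ∈ w, IsLetter S s) (g : G) :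
    ∃ C : (SimpleGraph.mulCayley S).Walk g (g * w.prod), C.length = w.length ∧
      ∀ u v, w = u ++ v → u ≠ [] → g * u.prod ∈ C.support.tail := by
  induction w generalizing g with
  | nil =>
    refine ⟨(SimpleGraph.Walk.nil : (SimpleGraph.mulCayley S).Walk g g).copy rfl (by simp),
      by rw [SimpleGraph.Walk.length_copy]; rfl, ?_⟩
    rintro u v h hu
    simp_all
  | cons s w ih =>
    obtain ⟨C, hl, hC⟩ := ih (fun t ht => hw t (by simp [ht])) (g * s)
    have hs := hw s (by simp)
    have hadj : (SimpleGraph.mulCayley S).Adj g (g * s) := by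
      rw [SimpleGraph.mulCayley_adj]
      refine ⟨fun h => hs.1 (by simpa using h.symm), ?_⟩
      simpa using hs.2
    refine ⟨(SimpleGraph.Walk.cons hadj C).copy rfl (by simp [mul_assoc]), by simp [hl], ?_⟩
    rintro u v h hu
    cases u with
    | nil => exact absurd rfl hu
    | cons a u =>
      obtain ⟨rfl, rfl⟩ : s = a ∧ w = u ++ v := by simpa using h
      simp only [SimpleGraph.Walk.support_copy, SimpleGraph.Walk.support_cons, List.tail_cons,
        List.prod_cons, ← mul_assoc]
      by_cases hu' : u = []
      · subst hu'; simp
      · exact List.mem_of_mem_tail (hC u v rfl hu')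

theorem IsHamWord.exists_isHamiltonianCycle [DecidableEq G] [Finite G] {S : Set G} {w : List G}
    (h : IsHamWord S w) (hG : 3 ≤ Nat.card G) :
    ∃ (v : G) (C : (SimpleGraph.mulCayley S).Walk v v), C.IsHamiltonianCycle := by
  obtain ⟨C, hl, hC⟩ := exists_walk_of_word w h.letter 1
  simp only [one_mul] at hC
  have key : ∀ x (e : 1 * w.prod = x), x = 1 →
      ∃ C : (SimpleGraph.mulCayley S).Walk 1 1, C.length = Nat.card G ∧
        ∀ g, g ∈ C.support.tail := by
    rintro x e rfl
    refine ⟨C.copy rfl e, by simp [hl, h.length_eq], fun g => ?_⟩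
    rw [SimpleGraph.Walk.support_copy]
    obtain ⟨u, v, huv, hu⟩ := h.visits g
    -- The tail of the support omits the starting vertex, but the closed walk meets it again at its
    -- end, so the empty prefix is replaced by the whole word.
    by_cases hu' : u = []
    · subst hu'
      have hw : w ≠ [] := by
        rintro rfl
        have := h.length_eq
        simp at this
        omega
      have := hC w [] (by simp) hw
      rw [← hu]
      simpa only [h.prod_eq_one, List.prod_nil] using this
    · rw [← hu]; exact hC u v huv hu'
  obtain ⟨D, hD, hD'⟩ := key _ rfl (by simp [h.prod_eq_one])
  have := Fintype.ofFinite G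
  have hnil : ¬ D.Nil := by
    rw [← SimpleGraph.Walk.length_eq_zero_iff, hD]; omega
  have hlen : D.support.tail.length = Fintype.card G := by
    simp [hD]
  -- A list of length `Nat.card G` that contains every element has no repetition.
  have hnd : D.support.tail.Nodup := by
    have huniv : D.support.tail.toFinset = Finset.univ :=
      Finset.eq_univ_of_forall fun g => List.mem_toFinset.2 (hD' g)
    have hcard : D.support.tail.dedup.length = D.support.tail.length := by
      rw [← List.card_toFinset, huniv, hlen, Finset.card_univ]
    rw [← List.dedup_eq_self]
    exact (List.dedup_sublist _).eq_of_length hcard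
  refine ⟨1, D, ?_⟩
  rw [SimpleGraph.Walk.isHamiltonianCycle_iff_isCycle_and_support_count_tail_eq_one]
  refine ⟨?_, fun a => List.count_eq_one_of_mem hnd (hD' a)⟩
  rw [SimpleGraph.Walk.isCycle_iff_isPath_tail_and_le_length]
  refine ⟨?_, by omega⟩
  rw [SimpleGraph.Walk.isPath_def, SimpleGraph.Walk.support_tail_of_not_nil _ hnil]
  exact hnd

end Words

/-- A property that holds at `1` and is
invariant under right multiplication by `S` holds everywhere when the Cayley graph is connected. -/
lemma mulCayley_connected_induction {G : Type*} [Group G] {S : Set G}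
    (hS : (SimpleGraph.mulCayley S).Connected) {P : G → Prop} (h1 : P 1)
    (hP : ∀ g, ∀ s ∈ S, P g ↔ P (g * s)) (g : G) : P g := by
  obtain ⟨C⟩ := hS.preconnected 1 g
  have key : ∀ {u v : G}, (SimpleGraph.mulCayley S).Walk u v → P u → P v := by
    intro u v C
    induction C with
    | nil => exact id
    | cons h C ih =>
      intro hu
      apply ih
      rw [SimpleGraph.mulCayley_adj'] at h
      obtain ⟨-, s, hs, h | h⟩ := h
      · rw [← h]; exact (hP _ s hs).1 hu
      · rw [h] at hu; exact (hP _ s hs).2 hu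
  exact key C h1

/-! ### The group in coordinates, and the factor group lemma -/

/-- The direct product of the dihedral group of order `2pq` (for coprime `p`, `q`) and the cyclic
group of order `r`, in coordinates. -/
inductive DihZ (p q r : ℕ) : Type
  | rot (a : ZMod p) (b : ZMod q) (c : ZMod r) : DihZ p q r
  | ref (a : ZMod p) (b : ZMod q) (c : ZMod r) : DihZ p q r

namespace DihZ

variable {p q r : ℕ}

instance : Mul (DihZ p q r) where
  mul
    | rot a b c, rot a' b' c' => rot (a + a') (b + b') (c + c')
    | rot a b c, ref a' b' c' => ref (a + a') (b + b') (c + c')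
    | ref a b c, rot a' b' c' => ref (a - a') (b - b') (c + c')
    | ref a b c, ref a' b' c' => rot (a - a') (b - b') (c + c')

instance : One (DihZ p q r) := ⟨rot 0 0 0⟩

instance : Inv (DihZ p q r) where
  inv
    | rot a b c => rot (-a) (-b) (-c)
    | ref a b c => ref a b (-c)

@[simp] lemma rot_mul_rot (a a' : ZMod p) (b b' : ZMod q) (c c' : ZMod r) :
    rot a b c * rot a' b' c' = rot (a + a') (b + b') (c + c') := rfl
@[simp] lemma rot_mul_ref (a a' : ZMod p) (b b' : ZMod q) (c c' : ZMod r) :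
    rot a b c * ref a' b' c' = ref (a + a') (b + b') (c + c') := rfl
@[simp] lemma ref_mul_rot (a a' : ZMod p) (b b' : ZMod q) (c c' : ZMod r) :
    ref a b c * rot a' b' c' = ref (a - a') (b - b') (c + c') := rfl
@[simp] lemma ref_mul_ref (a a' : ZMod p) (b b' : ZMod q) (c c' : ZMod r) :
    ref a b c * ref a' b' c' = rot (a - a') (b - b') (c + c') := rfl
lemma one_def : (1 : DihZ p q r) = rot 0 0 0 := rfl

instance : Group (DihZ p q r) where
  mul_assoc := by
    rintro (⟨a, b, c⟩ | ⟨a, b, c⟩) (⟨a', b', c'⟩ | ⟨a', b', c'⟩) (⟨x, y, z⟩ | ⟨x, y, z⟩) <;>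
      simp <;> refine ⟨?_, ?_, ?_⟩ <;> ring
  one_mul := by rintro (⟨a, b, c⟩ | ⟨a, b, c⟩) <;> simp [one_def]
  mul_one := by rintro (⟨a, b, c⟩ | ⟨a, b, c⟩) <;> simp [one_def]
  inv_mul_cancel := by
    rintro (⟨a, b, c⟩ | ⟨a, b, c⟩)
    · change rot (-a + a) (-b + b) (-c + c) = rot 0 0 0
      simp
    · change rot (a - a) (b - b) (-c + c) = rot 0 0 0
      simp

@[simp] lemma inv_rot (a : ZMod p) (b : ZMod q) (c : ZMod r) :
    (rot a b c)⁻¹ = rot (-a) (-b) (-c) := rfl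
@[simp] lemma inv_ref (a : ZMod p) (b : ZMod q) (c : ZMod r) :
    (ref a b c)⁻¹ = ref a b (-c) := rfl

@[simp] lemma rot_pow (a : ZMod p) (b : ZMod q) (c : ZMod r) (n : ℕ) :
    (rot a b c) ^ n = rot ((n : ZMod p) * a) ((n : ZMod q) * b) ((n : ZMod r) * c) := by
  induction n with
  | zero => simp [one_def]
  | succ n ih => rw [pow_succ, ih]; simp; refine ⟨?_, ?_, ?_⟩ <;> ring

@[simp] lemma rot_eq_one {a : ZMod p} {b : ZMod q} {c : ZMod r} :
    rot a b c = 1 ↔ a = 0 ∧ b = 0 ∧ c = 0 := by simp [one_def]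

@[simp] lemma ref_ne_one (a : ZMod p) (b : ZMod q) (c : ZMod r) : ref a b c ≠ 1 := by
  simp [one_def]

/-- Coordinates on the group. -/
def equivProd : DihZ p q r ≃ Bool × ZMod p × ZMod q × ZMod r where
  toFun
    | rot a b c => (false, a, b, c)
    | ref a b c => (true, a, b, c)
  invFun
    | (false, a, b, c) => rot a b c
    | (true, a, b, c) => ref a b c
  left_inv := by rintro (_ | _) <;> rfl
  right_inv := by rintro ⟨_ | _, _⟩ <;> rfl

lemma card_eq : Nat.card (DihZ p q r) = 2 * (p * (q * r)) := by
  rw [Nat.card_congr equivProd]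
  simp [Nat.card_prod]

instance [NeZero p] [NeZero q] [NeZero r] : Finite (DihZ p q r) := Finite.of_equiv _ equivProd.symm

/-- Interchanging the two primes. -/
def swap : DihZ p q r ≃* DihZ q p r where
  toFun
    | rot a b c => rot b a c
    | ref a b c => ref b a c
  invFun
    | rot a b c => rot b a c
    | ref a b c => ref b a c
  left_inv := by rintro (_ | _) <;> rfl
  right_inv := by rintro (_ | _) <;> rfl
  map_mul' := by rintro (_ | _) (_ | _) <;> rfl

/-- The coordinates of an element of `DihedralGroup (p * q) × Multiplicative (ZMod r)`. -/
def ofProd (h : p.Coprime q) :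
    DihedralGroup (p * q) × Multiplicative (ZMod r) ≃* DihZ p q r where
  toFun
    | (.r i, z) => rot (ZMod.chineseRemainder h i).1 (ZMod.chineseRemainder h i).2 z.toAdd
    -- The sign reconciles `sr i * r j = sr (i + j)` with the rule here, where a reflection times a
    -- rotation subtracts.
    | (.sr i, z) => ref (-(ZMod.chineseRemainder h i).1) (-(ZMod.chineseRemainder h i).2) z.toAdd
  invFun
    | rot a b c => (.r ((ZMod.chineseRemainder h).symm (a, b)), .ofAdd c)
    | ref a b c => (.sr ((ZMod.chineseRemainder h).symm (-a, -b)), .ofAdd c)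
  left_inv := by rintro ⟨_ | _, _⟩ <;> simp
  right_inv := by rintro (_ | _) <;> simp
  map_mul' := by
    rintro ⟨_ | _, _⟩ ⟨_ | _, _⟩ <;> simp <;> refine ⟨?_, ?_⟩ <;> ring

/-- Whether an element is a reflection. -/
def isRef : DihZ p q r → Prop
  | rot _ _ _ => False
  | ref _ _ _ => True

/-- The coordinate modulo `p`. -/
def fstC : DihZ p q r → ZMod p
  | rot a _ _ => a
  | ref a _ _ => a

/-- The coordinate modulo `q`. -/
def sndC : DihZ p q r → ZMod q
  | rot _ b _ => b
  | ref _ b _ => b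

/-- The coordinate modulo `r`. -/
def trdC : DihZ p q r → ZMod r
  | rot _ _ c => c
  | ref _ _ c => c

section
variable (a : ZMod p) (b : ZMod q) (c : ZMod r)
@[simp] lemma isRef_rot : isRef (rot a b c) ↔ False := Iff.rfl
@[simp] lemma isRef_ref : isRef (ref a b c) ↔ True := Iff.rfl
@[simp] lemma fstC_rot : fstC (rot a b c) = a := rfl
@[simp] lemma fstC_ref : fstC (ref a b c) = a := rfl
@[simp] lemma sndC_rot : sndC (rot a b c) = b := rfl
@[simp] lemma sndC_ref : sndC (ref a b c) = b := rfl
@[simp] lemma trdC_rot : trdC (rot a b c) = c := rfl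
@[simp] lemma trdC_ref : trdC (ref a b c) = c := rfl
variable (x : DihZ p q r)
@[simp] lemma isRef_rot_mul : isRef (rot a b c * x) ↔ isRef x := by cases x <;> rfl
@[simp] lemma fstC_rot_mul : fstC (rot a b c * x) = a + fstC x := by cases x <;> rfl
@[simp] lemma sndC_rot_mul : sndC (rot a b c * x) = b + sndC x := by cases x <;> rfl
@[simp] lemma trdC_rot_mul : trdC (rot a b c * x) = c + trdC x := by cases x <;> rfl
end

lemma ext_coord {x y : DihZ p q r} (h : isRef x ↔ isRef y) (h1 : fstC x = fstC y)
    (h2 : sndC x = sndC y) (h3 : trdC x = trdC y) : x = y := by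
  cases x <;> cases y <;> simp_all

/-- Every class modulo the subgroup of order `r` is visited. -/
def CoverR (w : List (DihZ p q r)) : Prop :=
  ∀ g : DihZ p q r, ∃ x, Visits w x ∧ (isRef x ↔ isRef g) ∧ fstC x = fstC g ∧ sndC x = sndC g

/-- Every class modulo the subgroup of order `qr` is visited. -/
def CoverQR (w : List (DihZ p q r)) : Prop :=
  ∀ g : DihZ p q r, ∃ x, Visits w x ∧ (isRef x ↔ isRef g) ∧ fstC x = fstC g

/-- Every class modulo the subgroup of order `pq` is visited. -/
def CoverPQ (w : List (DihZ p q r)) : Prop :=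
  ∀ g : DihZ p q r, ∃ x, Visits w x ∧ (isRef x ↔ isRef g) ∧ trdC x = trdC g

lemma exists_lt_mul_eq [Fact p.Prime] {a : ZMod p} (ha : a ≠ 0) (x : ZMod p) :
    ∃ i < p, (i : ZMod p) * a = x :=
  ⟨(x / a).val, ZMod.val_lt _, by rw [ZMod.natCast_zmod_val, div_mul_cancel₀ _ ha]⟩

lemma exists_lt_mul_eq_mul_eq [Fact p.Prime] [Fact q.Prime] (hpq : p ≠ q) {a : ZMod p}
    {b : ZMod q} (ha : a ≠ 0) (hb : b ≠ 0) (x : ZMod p) (y : ZMod q) :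
    ∃ i < p * q, (i : ZMod p) * a = x ∧ (i : ZMod q) * b = y := by
  obtain ⟨i, -, hi⟩ := exists_lt_mul_eq ha x
  obtain ⟨j, -, hj⟩ := exists_lt_mul_eq hb y
  have hco : p.Coprime q := (Nat.coprime_primes (Fact.out) (Fact.out)).2 hpq
  refine ⟨Nat.chineseRemainder hco i j, Nat.chineseRemainder_lt_mul hco _ _
    (Fact.out : p.Prime).ne_zero (Fact.out : q.Prime).ne_zero, ?_, ?_⟩
  · rw [(ZMod.natCast_eq_natCast_iff _ _ _).2 (Nat.chineseRemainder hco i j).2.1, hi]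
  · rw [(ZMod.natCast_eq_natCast_iff _ _ _).2 (Nat.chineseRemainder hco i j).2.2, hj]

section Power
variable [Fact p.Prime] [Fact q.Prime] [Fact r.Prime] {w : List (DihZ p q r)}

/-- Factor group lemma: copy number `j` of the word visits the translates by `rot 0 0 (j * c)`, and
the multiples of `c ≠ 0` fill each class. The next two lemmas do the same for other quotients. -/
lemma CoverR.wordPow (h : CoverR w) {c : ZMod r} (hw : w.prod = rot 0 0 c) (hc : c ≠ 0)
    (g : DihZ p q r) : Visits (wordPow w r) g := by
  obtain ⟨x, hx, h1, h2, h3⟩ := h g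
  obtain ⟨j, hj, hj'⟩ := exists_lt_mul_eq hc (trdC g - trdC x)
  have := hx.wordPow hj
  rw [hw] at this
  convert this using 1
  apply ext_coord <;> simp [*]

lemma CoverQR.wordPow (h : CoverQR w) {b : ZMod q} {c : ZMod r} (hw : w.prod = rot 0 b c)
    (hb : b ≠ 0) : CoverR (wordPow w q) := by
  intro g
  obtain ⟨x, hx, h1, h2⟩ := h g
  obtain ⟨j, hj, hj'⟩ := exists_lt_mul_eq hb (sndC g - sndC x)
  have := hx.wordPow hj
  rw [hw] at this
  exact ⟨_, this, by simp [*], by simp [*], by simp [*]⟩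

lemma CoverPQ.wordPow (hpq : p ≠ q) (h : CoverPQ w) {a : ZMod p} {b : ZMod q}
    (hw : w.prod = rot a b 0) (ha : a ≠ 0) (hb : b ≠ 0) (g : DihZ p q r) :
    Visits (wordPow w (p * q)) g := by
  obtain ⟨x, hx, h1, h2⟩ := h g
  obtain ⟨j, hj, hj', hj''⟩ := exists_lt_mul_eq_mul_eq hpq ha hb (fstC g - fstC x) (sndC g - sndC x)
  have := hx.wordPow hj
  rw [hw] at this
  convert this using 1
  apply ext_coord <;> simp [*]

end Power

end DihZ

/-! ### Snaking a closed word through the cosets of a central element -/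

section Snake

variable {G : Type*} [Group G]

/-- Replace consecutive letters `s`, `t` of a word by `z ^ m`, `s`, `z ^ (-m)`, `t`. -/
def snake (z : G) (m : ℕ) : List G → List G
  | s :: t :: w => List.replicate m z ++ (s :: (List.replicate m z⁻¹ ++ (t :: snake z m w)))
  | w => w

lemma length_snake (z : G) (m : ℕ) : ∀ w : List G, Even w.length →
    (snake z m w).length = (m + 1) * w.length
  | [], _ => by simp [snake]
  | [s], h => by simp at h
  | s :: t :: w, h => by
    have := length_snake z m w (by simpa [Nat.even_add_one] using h)
    simp [snake, this]; ring

lemma mem_snake {z : G} {m : ℕ} {x : G} : ∀ {w : List G}, x ∈ snake z m w →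
    x ∈ w ∨ x = z ∨ x = z⁻¹
  | [], h => by simp [snake] at h
  | [s], h => Or.inl h
  | s :: t :: w, h => by
    simp only [snake, List.mem_append, List.mem_cons, List.mem_replicate] at h
    rcases h with h | h | h | h | h
    · exact Or.inr (Or.inl h.2)
    · simp [h]
    · exact Or.inr (Or.inr h.2)
    · simp [h]
    · rcases mem_snake h with h | h
      · simp [h]
      · exact Or.inr h

lemma prod_snake {z : G} (hz : ∀ x, Commute z x) (m : ℕ) :
    ∀ w : List G, (snake z m w).prod = w.prod
  | [] => rfl
  | [s] => rfl
  | s :: t :: w => by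
    have h1 : z ^ m * s = s * z ^ m := ((hz s).pow_left m).eq
    simp only [snake, List.prod_append, List.prod_cons, List.prod_replicate, prod_snake hz m w]
    rw [← mul_assoc, h1]
    simp [mul_assoc]

/-- After a prefix `u` of even length the snake climbs from `u` to `u * z ^ m`; after one of odd
length it descends from `u * z ^ m` to `u`. The full word is excluded because no column is inserted
after the last letter. -/
lemma visits_snake {z : G} (hz : ∀ x, Commute z x) {m : ℕ} :
    ∀ {w : List G}, Even w.length → ∀ {u v : List G}, w = u ++ v → v ≠ [] → ∀ {j : ℕ}, j ≤ m →
      Visits (snake z m w) (u.prod * z ^ j)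
  | [], _, u, v, h, hv, _, _ => by simp_all
  | [s], he, _, _, _, _, _, _ => by simp at he
  | s :: t :: w, he, [], v, h, hv, j, hj => by
    rw [snake, List.prod_nil, one_mul]; exact (visits_replicate z hj).append_right _
  | s :: t :: w, he, [a], v, h, hv, j, hj => by
    obtain ⟨rfl, rfl⟩ : s = a ∧ t :: w = v := by simpa using h
    have := ((((visits_replicate z⁻¹ (Nat.sub_le m j)).append_right (t :: snake z m w)).cons s
      ).append_left (List.replicate m z))
    rw [snake]
    convert this using 1
    have h1 : z ^ m * s = s * z ^ m := ((hz s).pow_left m).eq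
    rw [List.prod_replicate, ← mul_assoc, h1, List.prod_singleton, mul_assoc]
    congr 1
    rw [inv_pow, eq_mul_inv_iff_mul_eq, ← pow_add]
    congr 1
    omega
  | s :: t :: w, he, a :: b :: u, v, h, hv, j, hj => by
    obtain ⟨rfl, rfl, rfl⟩ : s = a ∧ t = b ∧ w = u ++ v := by simpa using h
    have ih := visits_snake hz (m := m) (by simpa [Nat.even_add_one] using he) rfl hv hj
    have := (((ih.cons t).append_left (List.replicate m z⁻¹)).cons s).append_left
      (List.replicate m z)
    rw [snake]
    convert this using 1
    have h1 : z ^ m * s = s * z ^ m := ((hz s).pow_left m).eq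
    rw [List.prod_replicate, ← mul_assoc (z ^ m), h1]
    simp [mul_assoc]

end Snake

/-! ### Lifting cycles modulo the subgroup of order `r`; prisms -/

namespace DihZ

variable {p q r : ℕ}

/-- A word that traces a hamiltonian cycle modulo the subgroup of order `r`, with product `c`. -/
structure IsCycleModR (S : Set (DihZ p q r)) (c : ZMod r) (w : List (DihZ p q r)) : Prop where
  letter : ∀ s ∈ w, IsLetter S s
  cover : CoverR w
  prod_eq : w.prod = rot 0 0 c
  length_eq : w.length = 2 * (p * q)

variable {S : Set (DihZ p q r)} {w w' : List (DihZ p q r)}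

section
variable [Fact p.Prime] [Fact q.Prime] [Fact r.Prime]

lemma IsCycleModR.exists_isHamWord {c : ZMod r} (h : IsCycleModR S c w) (hc : c ≠ 0) :
    ∃ W, IsHamWord S W :=
  ⟨wordPow w r,
    { letter := fun s hs => h.letter s (mem_wordPow hs)
      prod_eq_one := by simp [h.prod_eq]
      visits := h.cover.wordPow h.prod_eq hc
      length_eq := by rw [length_wordPow, h.length_eq, card_eq]; ring }⟩

lemma IsCycleModR.exists_isHamWord_of_rot_mem (h : IsCycleModR S 0 w) {z : ZMod r}
    (hz : z ≠ 0) (hzS : rot 0 0 z ∈ S) : ∃ W, IsHamWord S W := by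
  have hcomm : ∀ x : DihZ p q r, Commute (rot 0 0 z) x := by
    rintro (_ | _) <;> simp [Commute, SemiconjBy, add_comm]
  have hr : 0 < r := (Fact.out : r.Prime).pos
  have hev : Even w.length := by simp [h.length_eq]
  have hz' : IsLetter S (rot 0 0 z) := ⟨by simpa using hz, Or.inl hzS⟩
  refine ⟨snake (rot 0 0 z) (r - 1) w, ?_, ?_, ?_, ?_⟩
  · intro s hs
    rcases mem_snake hs with hs | rfl | rfl
    exacts [h.letter s hs, hz', hz'.inv]
  · rw [prod_snake hcomm, h.prod_eq]; rfl
  · intro g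
    have key : ∃ u v, w = u ++ v ∧ v ≠ [] ∧ (isRef u.prod ↔ isRef g) ∧ fstC u.prod = fstC g ∧
        sndC u.prod = sndC g := by
      obtain ⟨x, ⟨u, v, huv, rfl⟩, hx⟩ := h.cover g
      -- The full word lies in the same class as the empty prefix, which is used in its place.
      by_cases hv : v = []
      · refine ⟨[], w, rfl, ?_, ?_⟩
        · rintro rfl
          have h0 := h.length_eq
          have hp := (Fact.out : p.Prime).pos
          have hq := (Fact.out : q.Prime).pos
          have := Nat.mul_pos hp hq
          rw [List.length_nil] at h0
          omega
        · subst hv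
          rw [← List.append_nil u, ← huv, h.prod_eq] at hx
          exact hx
      · exact ⟨u, v, huv, hv, hx⟩
    obtain ⟨u, v, huv, hv, h1, h2, h3⟩ := key
    obtain ⟨j, hj, hj'⟩ := exists_lt_mul_eq hz (trdC g - trdC u.prod)
    have := visits_snake hcomm hev huv hv (by omega : j ≤ r - 1)
    convert this using 1
    rw [← ((hcomm u.prod).pow_left j).eq]
    apply ext_coord <;> simp [*]
  · rw [length_snake _ _ _ hev, h.length_eq, card_eq, Nat.sub_add_cancel hr]; ring

/-- Two words that are cycles modulo the subgroup of order `r` provide a hamiltonian cycle. -/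
lemma exists_isHamWord_of_pair {c c' : ZMod r} (h : IsCycleModR S c w) (h' : IsCycleModR S c' w')
    (hc : c ≠ c' ∨ ∃ z ≠ 0, rot 0 0 z ∈ S) : ∃ W, IsHamWord S W := by
  by_cases hc0 : c = 0
  · subst hc0
    rcases hc with hc | ⟨z, hz, hzS⟩
    · exact h'.exists_isHamWord hc.symm
    · exact h.exists_isHamWord_of_rot_mem hz hzS
  · exact h.exists_isHamWord hc0

end

/-- A word in rotations that traces a hamiltonian path of the rotations modulo the subgroup of
order `r`, with product `rot x y c`. -/
structure IsRotPath (S : Set (DihZ p q r)) (x : ZMod p) (y : ZMod q) (c : ZMod r)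
    (w : List (DihZ p q r)) : Prop where
  letter : ∀ s ∈ w, IsLetter S s
  cover : ∀ a b, ∃ c, Visits w (rot a b c)
  prod_eq : w.prod = rot x y c
  length_eq : w.length + 1 = p * q

lemma isLetter_ref {a : ZMod p} {b : ZMod q} {c : ZMod r} (h : ref a b c ∈ S) :
    IsLetter S (ref a b c) := ⟨by simp, Or.inl h⟩

lemma isLetter_ref_neg {a : ZMod p} {b : ZMod q} {c : ZMod r} (h : ref a b c ∈ S) :
    IsLetter S (ref a b (-c)) := (isLetter_ref h).inv

/-- One copy of the path covers the rotations, the other the reflections. A reflection inverts the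
`p`- and `q`-coordinates, so the second copy cancels the first there, while the `r`-coordinates add
up. -/
lemma IsRotPath.prism {x : ZMod p} {y : ZMod q} {v : ZMod r} (h : IsRotPath S x y v w)
    {a : ZMod p} {b : ZMod q} {c c' : ZMod r} (hf : IsLetter S (ref a b c))
    (hf' : IsLetter S (ref a b c')) :
    IsCycleModR S (2 * v + c + c') (w ++ ref a b c :: (w ++ [ref a b c'])) where
  letter s hs := by
    simp only [List.mem_append, List.mem_cons, List.not_mem_nil, or_false] at hs
    rcases hs with hs | rfl | hs | rfl
    exacts [h.letter s hs, hf, h.letter s hs, hf']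
  cover g := by
    cases g with
    | rot a' b' c' =>
      obtain ⟨z, hz⟩ := h.cover a' b'
      exact ⟨_, hz.append_right _, by simp⟩
    | ref a' b' c' =>
      obtain ⟨z, hz⟩ := h.cover (x + a - a') (y + b - b')
      refine ⟨_, ((hz.append_right _).cons _).append_left _, ?_⟩
      simp [h.prod_eq, ← add_sub_assoc]
  prod_eq := by
    simp [h.prod_eq]
    ring
  length_eq := by
    have := h.length_eq
    simp; omega

section
variable [Fact p.Prime] [Fact q.Prime] [Fact r.Prime]

lemma two_ne_zero_of_odd (hr : Odd r) : (2 : ZMod r) ≠ 0 := by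
  intro h
  have h2 : ((2 : ℕ) : ZMod r) = 0 := by exact_mod_cast h
  rw [ZMod.natCast_eq_zero_iff] at h2
  have := (Nat.prime_dvd_prime_iff_eq Fact.out Nat.prime_two).1 h2
  subst this
  exact absurd hr (by decide)

/-- Closing the prism with the reflection or with its inverse gives the products `2v + 2c` and `2v`.
-/
lemma IsRotPath.exists_isHamWord {x : ZMod p} {y : ZMod q} {v : ZMod r} (hr : Odd r)
    (h : IsRotPath S x y v w) {a : ZMod p} {b : ZMod q} {c : ZMod r} (hf : ref a b c ∈ S)
    (hc : c ≠ 0 ∨ ∃ z ≠ 0, rot 0 0 z ∈ S) : ∃ W, IsHamWord S W := by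
  refine exists_isHamWord_of_pair (h.prism (isLetter_ref hf) (isLetter_ref hf))
    (h.prism (isLetter_ref hf) (isLetter_ref_neg hf)) (hc.imp_left fun hc h0 => hc ?_)
  have : 2 * c = 0 := by linear_combination h0
  exact (mul_eq_zero.1 this).resolve_left (two_ne_zero_of_odd hr)

lemma IsRotPath.exists_isHamWord_of_ne_zero {x : ZMod p} {y : ZMod q} {v : ZMod r} (hr : Odd r)
    (h : IsRotPath S x y v w) {a : ZMod p} {b : ZMod q} (hf : ref a b 0 ∈ S)
    (hv : v ≠ 0) : ∃ W, IsHamWord S W := by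
  refine (h.prism (isLetter_ref hf) (isLetter_ref hf)).exists_isHamWord ?_
  simpa using ⟨two_ne_zero_of_odd hr, hv⟩

end

end DihZ

/-! ### Quotient cycles built from several reflections -/

namespace DihZ

variable {p q r : ℕ} {S : Set (DihZ p q r)} [Fact p.Prime] [Fact q.Prime] [Fact r.Prime]

lemma natCast_ne_zero_of_ne (h : p ≠ r) : (p : ZMod r) ≠ 0 := by
  rw [Ne, ZMod.natCast_eq_zero_iff]
  exact fun hd => h ((Nat.prime_dvd_prime_iff_eq Fact.out Fact.out).1 hd).symm

lemma two_le_of_fact : 2 ≤ p := (Fact.out : p.Prime).two_le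

/-! #### Two reflections -/

/-- The product of the two reflections generates the rotations modulo the subgroup of order `r`, so
alternating them runs through the whole quotient. -/
lemma isCycleModR_ref_ref (hpq : p ≠ q) {a a' : ZMod p} {b b' : ZMod q} {c c' : ZMod r}
    (hf : IsLetter S (ref a b c)) (hg : IsLetter S (ref a' b' c')) (ha : a ≠ a') (hb : b ≠ b') :
    IsCycleModR S (((p * q : ℕ) : ZMod r) * (c + c'))
      (wordPow [ref a b c, ref a' b' c'] (p * q)) where
  letter s hs := by
    have := mem_wordPow hs
    simp only [List.mem_cons, List.not_mem_nil, or_false] at this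
    rcases this with rfl | rfl
    exacts [hf, hg]
  cover g := by
    have key : ∀ x, Visits [ref a b c, ref a' b' c'] x → (isRef x ↔ isRef g) → ∃ x,
        Visits (wordPow [ref a b c, ref a' b' c'] (p * q)) x ∧ (isRef x ↔ isRef g) ∧
          fstC x = fstC g ∧ sndC x = sndC g := by
      intro x hx hxg
      obtain ⟨j, hj, hj', hj''⟩ := exists_lt_mul_eq_mul_eq hpq (sub_ne_zero.2 ha)
        (sub_ne_zero.2 hb) (fstC g - fstC x) (sndC g - sndC x)
      refine ⟨_, hx.wordPow hj, ?_⟩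
      simp only [List.prod_cons, List.prod_nil, mul_one, ref_mul_ref, rot_pow, isRef_rot_mul,
        fstC_rot_mul, sndC_rot_mul, hj', hj'', hxg, sub_add_cancel, and_self]
    cases g with
    | rot x y z => exact key 1 (Visits.one _) (by simp [one_def])
    | ref x y z => exact key (ref a b c) ⟨[_], [_], rfl, by simp⟩ (by simp)
  prod_eq := by simp
  length_eq := by simp; ring

lemma exists_isHamWord_ref_ref (hr : Odd r) (hpq : p ≠ q) (hpr : p ≠ r) (hqr : q ≠ r)
    {a a' : ZMod p} {b b' : ZMod q} {c c' : ZMod r}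
    (hf : ref a b c ∈ S) (hg : ref a' b' c' ∈ S) (ha : a ≠ a') (hb : b ≠ b')
    (hc : c ≠ 0 ∨ ∃ z ≠ 0, rot 0 0 z ∈ S) : ∃ W, IsHamWord S W := by
  refine exists_isHamWord_of_pair
    (isCycleModR_ref_ref hpq (isLetter_ref hf) (isLetter_ref hg) ha hb)
    (isCycleModR_ref_ref hpq (isLetter_ref_neg hf) (isLetter_ref hg) ha hb)
    (hc.imp_left fun hc h0 => hc ?_)
  have h1 : ((p : ZMod r) * q) * (2 * c) = 0 := by push_cast at h0; linear_combination h0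
  simpa [natCast_ne_zero_of_ne hpr, natCast_ne_zero_of_ne hqr, two_ne_zero_of_odd hr] using h1

/-! #### Three reflections -/

/-- A hamiltonian cycle modulo the subgroup of order `qr`. -/
def refWord (a a' : ZMod p) (b b' : ZMod q) (c c' d e : ZMod r) : List (DihZ p q r) :=
  wordPow [ref a' b d, ref a b c] (p - 2) ++ [ref a' b d, ref a b c', ref a' b d, ref a b' e]

lemma prod_refWord (a a' : ZMod p) (b b' : ZMod q) (c c' d e : ZMod r) :
    (refWord a a' b b' c c' d e).prod =
      rot 0 (b - b') (((p - 2 : ℕ) : ZMod r) * (d + c) + (2 * d + c' + e)) := by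
  have h : ((p - 2 : ℕ) : ZMod p) = -2 := by
    rw [Nat.cast_sub two_le_of_fact]; simp
  simp only [refWord, List.prod_append, prod_wordPow, List.prod_cons, List.prod_nil, mul_one,
    ref_mul_ref, rot_pow, ref_mul_rot, rot_mul_rot, h]
  congr 1 <;> ring

/-- Modulo the subgroup of order `qr` the letters `ref a b c`, `ref a b c'` and `ref a b' e`
coincide, so the word is two reflections alternating `p` times in a dihedral group of order `2p`.
The last two pairs differ from the others: `c'` allows one inversion, and `b'` makes the product
nontrivial modulo `q`. -/
lemma coverQR_refWord {a a' : ZMod p} (ha : a' ≠ a) (b b' : ZMod q) (c c' d e : ZMod r) :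
    CoverQR (refWord a a' b b' c c' d e) := by
  have hp : 2 ≤ p := two_le_of_fact
  set v := [ref a' b d, ref a b c] with hv
  have hvp : v.prod = rot (a' - a) 0 (d + c) := by simp [hv]
  have h1 : ∀ i < p, ∃ x, Visits (refWord a a' b b' c c' d e) x ∧ ¬ isRef x ∧
      fstC x = i * (a' - a) := by
    intro i hi
    rcases lt_or_ge i (p - 1) with hi' | hi'
    · rcases Nat.lt_or_ge i (p - 2) with hi'' | hi''
      · refine ⟨_, ((Visits.one v).wordPow hi'').append_right _, ?_, ?_⟩ <;> simp [hvp]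
      · obtain rfl : i = p - 2 := by omega
        refine ⟨_, (Visits.one _).append_left _, ?_, ?_⟩ <;> simp
    · obtain rfl : i = (p - 2) + 1 := by omega
      refine ⟨_, Visits.append_left (x := rot (a' - a) 0 (d + c')) _
        ⟨[ref a' b d, ref a b c'], [ref a' b d, ref a b' e], rfl, by simp⟩, ?_, ?_⟩
      · simp
      · simp; ring
  have h2 : ∀ i < p, ∃ x, Visits (refWord a a' b b' c c' d e) x ∧ isRef x ∧
      fstC x = i * (a' - a) + a' := by
    intro i hi
    rcases lt_or_ge i (p - 1) with hi' | hi'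
    · rcases Nat.lt_or_ge i (p - 2) with hi'' | hi''
      · have h0 : Visits v (ref a' b d) := ⟨[ref a' b d], [ref a b c], rfl, by simp⟩
        refine ⟨_, (h0.wordPow hi'').append_right _, ?_, ?_⟩ <;> simp [hvp]
      · obtain rfl : i = p - 2 := by omega
        refine ⟨_, Visits.append_left (x := ref a' b d) _
          ⟨[ref a' b d], [ref a b c', ref a' b d, ref a b' e], rfl, by simp⟩, ?_, ?_⟩ <;>
          simp
    · obtain rfl : i = (p - 2) + 1 := by omega
      refine ⟨_, Visits.append_left (x := ref (a' - a + a') b (d + c' + d)) _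
        ⟨[ref a' b d, ref a b c', ref a' b d], [ref a b' e], rfl, ?_⟩, ?_, ?_⟩
      · simp; refine ⟨?_, ?_⟩ <;> ring
      · simp
      · simp; ring
  intro g
  cases g with
  | rot x y z =>
    obtain ⟨i, hi, hi'⟩ := exists_lt_mul_eq (sub_ne_zero.2 ha) x
    obtain ⟨x, hx, hx', hx''⟩ := h1 i hi
    exact ⟨x, hx, by simpa using hx', by simp [hx'', hi']⟩
  | ref x y z =>
    obtain ⟨i, hi, hi'⟩ := exists_lt_mul_eq (sub_ne_zero.2 ha) (x - a')
    obtain ⟨x, hx, hx', hx''⟩ := h2 i hi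
    exact ⟨x, hx, by simpa using hx', by simp [hx'', hi']⟩

lemma isCycleModR_ref_ref_ref {a a' : ZMod p} {b b' : ZMod q} {c c' d e : ZMod r}
    (hf : IsLetter S (ref a b c)) (hf' : IsLetter S (ref a b c')) (hg : IsLetter S (ref a' b d))
    (hh : IsLetter S (ref a b' e)) (ha : a' ≠ a) (hb : b' ≠ b) :
    IsCycleModR S ((q : ZMod r) * (((p - 2 : ℕ) : ZMod r) * (d + c) + (2 * d + c' + e)))
      (wordPow (refWord a a' b b' c c' d e) q) where
  letter s hs := by
    rcases List.mem_append.1 (mem_wordPow hs) with hs | hs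
    · have := mem_wordPow hs
      simp only [List.mem_cons, List.not_mem_nil, or_false] at this
      rcases this with rfl | rfl
      exacts [hg, hf]
    · simp only [List.mem_cons, List.not_mem_nil, or_false] at hs
      rcases hs with rfl | rfl | rfl | rfl
      exacts [hg, hf', hg, hh]
  cover := (coverQR_refWord ha b b' c c' d e).wordPow (prod_refWord a a' b b' c c' d e)
    (sub_ne_zero.2 hb.symm)
  prod_eq := by simp [prod_refWord]
  length_eq := by
    have hp : 2 ≤ p := two_le_of_fact
    have : (refWord a a' b b' c c' d e).length = 2 * p := by
      simp [refWord]; omega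
    rw [length_wordPow, this]; ring

lemma exists_isHamWord_ref_ref_ref (hr : Odd r) (hqr : q ≠ r) {a a' : ZMod p} {b b' : ZMod q}
    {c d e : ZMod r} (hf : ref a b c ∈ S) (hg : ref a' b d ∈ S) (hh : ref a b' e ∈ S)
    (ha : a' ≠ a) (hb : b' ≠ b) (hc : c ≠ 0 ∨ ∃ z ≠ 0, rot 0 0 z ∈ S) :
    ∃ W, IsHamWord S W := by
  refine exists_isHamWord_of_pair
    (isCycleModR_ref_ref_ref (isLetter_ref hf) (isLetter_ref hf) (isLetter_ref hg)
      (isLetter_ref hh) ha hb)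
    (isCycleModR_ref_ref_ref (isLetter_ref hf) (isLetter_ref_neg hf) (isLetter_ref hg)
      (isLetter_ref hh) ha hb) (hc.imp_left fun hc h0 => hc ?_)
  have h1 : (q : ZMod r) * (2 * c) = 0 := by linear_combination h0
  simpa [natCast_ne_zero_of_ne hqr, two_ne_zero_of_odd hr] using h1

/-! #### Two reflections and a rotation -/

lemma isLetter_rot {a : ZMod p} {b : ZMod q} {c : ZMod r} (h : rot a b c ∈ S)
    (h0 : a ≠ 0 ∨ b ≠ 0 ∨ c ≠ 0) : IsLetter S (rot a b c) := ⟨by simp; tauto, Or.inl h⟩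

lemma isLetter_rot_neg {a : ZMod p} {b : ZMod q} {c : ZMod r} (h : IsLetter S (rot a b c)) :
    IsLetter S (rot (-a) (-b) (-c)) := h.inv

/-- Modulo the subgroup of order `qr` the two reflections agree and the block is a prism over the
powers of the rotation. Their difference `b - b'` makes its product nontrivial modulo `q`, so `q`
repetitions cover everything modulo the subgroup of order `r`. -/
lemma isCycleModR_ref_ref_rot {a a' : ZMod p} {b b' : ZMod q} {c d e : ZMod r}
    (hf : IsLetter S (ref a b c)) (hg : IsLetter S (ref a b' d)) (ht : IsLetter S (rot a' 0 e))
    (ha : a' ≠ 0) (hb : b' ≠ b) :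
    IsCycleModR S ((q : ZMod r) * (2 * ((p - 1 : ℕ) : ZMod r) * e + c + d))
      (wordPow (List.replicate (p - 1) (rot a' 0 e) ++
        ref a b c :: (List.replicate (p - 1) (rot a' 0 e) ++ [ref a b' d])) q) := by
  have hp : 2 ≤ p := two_le_of_fact
  have hprod : (List.replicate (p - 1) (rot a' 0 e) ++
        ref a b c :: (List.replicate (p - 1) (rot a' 0 e) ++ [ref a b' d])).prod =
      rot 0 (b - b') (2 * ((p - 1 : ℕ) : ZMod r) * e + c + d) := by
    simp only [List.prod_append, List.prod_replicate, rot_pow, List.prod_cons, List.prod_nil,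
      mul_one, rot_mul_ref, ref_mul_ref, rot_mul_rot]
    congr 1 <;> ring
  refine ⟨?_, ?_, ?_, ?_⟩
  · intro s hs
    have := mem_wordPow hs
    simp only [List.mem_append, List.mem_replicate, List.mem_cons, List.not_mem_nil,
      or_false] at this
    rcases this with ⟨-, rfl⟩ | rfl | ⟨-, rfl⟩ | rfl
    exacts [ht, hf, ht, hg]
  · refine CoverQR.wordPow ?_ hprod (sub_ne_zero.2 hb.symm)
    intro g
    cases g with
    | rot x y z =>
      obtain ⟨i, hi, hi'⟩ := exists_lt_mul_eq ha x
      exact ⟨_, (visits_replicate _ (by omega : i ≤ p - 1)).append_right _, by simp, by simp [hi']⟩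
    | ref x y z =>
      obtain ⟨i, hi, hi'⟩ := exists_lt_mul_eq ha (((p - 1 : ℕ) : ZMod p) * a' + a - x)
      refine ⟨_, (((visits_replicate _ (by omega : i ≤ p - 1)).append_right _).cons _).append_left
        _, by simp, ?_⟩
      simp [hi']; ring
  · rw [prod_wordPow, hprod]; simp
  · simp
    have : p - 1 + (p - 1 + 1 + 1) = 2 * p := by omega
    rw [this]; ring

lemma exists_isHamWord_ref_ref_rot (hr : Odd r) (hqr : q ≠ r) {a a' : ZMod p} {b b' : ZMod q}
    {c d e : ZMod r} (hf : ref a b c ∈ S) (hg : ref a b' d ∈ S) (ht : rot a' 0 e ∈ S)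
    (ha : a' ≠ 0) (hb : b' ≠ b) (hc : c ≠ 0 ∨ ∃ z ≠ 0, rot 0 0 z ∈ S) :
    ∃ W, IsHamWord S W := by
  have ht' := isLetter_rot ht (Or.inl ha)
  refine exists_isHamWord_of_pair
    (isCycleModR_ref_ref_rot (isLetter_ref hf) (isLetter_ref hg) ht' ha hb)
    (isCycleModR_ref_ref_rot (isLetter_ref_neg hf) (isLetter_ref hg) ht' ha hb)
    (hc.imp_left fun hc h0 => hc ?_)
  have h1 : (q : ZMod r) * (2 * c) = 0 := by linear_combination h0
  simpa [natCast_ne_zero_of_ne hqr, two_ne_zero_of_odd hr] using h1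

/-- Factor group lemma for the rotation subgroup of order `pq`: going up the powers of the rotation
and back down by its inverse is a cycle in the quotient of order `2r`, and its product generates
that subgroup. -/
lemma exists_isHamWord_of_coverPQ (hpq : p ≠ q) {a a' t : ZMod p} {b b' : ZMod q} {e : ZMod r}
    (hf : IsLetter S (ref a b 0)) (hg : IsLetter S (ref a' b' 0)) (ht : IsLetter S (rot t 0 e))
    (he : e ≠ 0) (hb : b' ≠ b) (h : 2 * ((r - 1 : ℕ) : ZMod p) * t + a - a' ≠ 0) :
    ∃ W, IsHamWord S W := by
  have hr : 2 ≤ r := two_le_of_fact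
  set w := List.replicate (r - 1) (rot t 0 e) ++
    ref a b 0 :: (List.replicate (r - 1) (rot (-t) (-0) (-e)) ++ [ref a' b' 0]) with hw
  have hprod : w.prod = rot (2 * ((r - 1 : ℕ) : ZMod p) * t + a - a') (b - b') 0 := by
    simp only [hw, List.prod_append, List.prod_replicate, rot_pow, List.prod_cons, List.prod_nil,
      mul_one, rot_mul_ref, ref_mul_ref, rot_mul_rot]
    congr 1 <;> ring
  have hcov : CoverPQ w := by
    intro g
    cases g with
    | rot x y z =>
      obtain ⟨i, hi, hi'⟩ := exists_lt_mul_eq he z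
      exact ⟨_, (visits_replicate _ (by omega : i ≤ r - 1)).append_right _, by simp, by simp [hi']⟩
    | ref x y z =>
      obtain ⟨i, hi, hi'⟩ := exists_lt_mul_eq he (((r - 1 : ℕ) : ZMod r) * e - z)
      refine ⟨_, (((visits_replicate _ (by omega : i ≤ r - 1)).append_right _).cons _).append_left
        _, by simp, ?_⟩
      simp [hi']
  refine ⟨wordPow w (p * q), ?_, ?_, hcov.wordPow hpq hprod h (sub_ne_zero.2 hb.symm), ?_⟩
  · intro s hs
    have := mem_wordPow hs
    simp only [hw, List.mem_append, List.mem_replicate, List.mem_cons, List.not_mem_nil,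
      or_false] at this
    rcases this with ⟨-, rfl⟩ | rfl | ⟨-, rfl⟩ | rfl
    exacts [ht, hf, isLetter_rot_neg ht, hg]
  · rw [prod_wordPow, hprod]; simp [one_def]
  · rw [length_wordPow, card_eq]
    have : w.length = 2 * r := by simp [hw]; omega
    rw [this]; ring

/-- The cycle modulo the subgroup of order `pq` is tried with the rotation and with its inverse. If
both fail, then `a = a'` and `p` divides `r - 1`. Hence `p < r`, so `p - 1` is nonzero modulo `r`
and the word of `isCycleModR_ref_ref_rot` has nontrivial product. -/
lemma exists_isHamWord_ref_ref_rot_of_zero (hp : Odd p) (hr : Odd r) (hpq : p ≠ q) (hqr : q ≠ r)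
    {a a' t : ZMod p} {b b' : ZMod q} {e : ZMod r} (hf : ref a b 0 ∈ S) (hg : ref a' b' 0 ∈ S)
    (ht : rot t 0 e ∈ S) (ht0 : t ≠ 0) (he : e ≠ 0) (hb : b' ≠ b) : ∃ W, IsHamWord S W := by
  have htl := isLetter_rot ht (Or.inl ht0)
  by_cases h1 : 2 * ((r - 1 : ℕ) : ZMod p) * t + a - a' = 0
  swap
  · exact exists_isHamWord_of_coverPQ hpq (isLetter_ref hf) (isLetter_ref hg) htl he hb h1
  by_cases h2 : 2 * ((r - 1 : ℕ) : ZMod p) * -t + a - a' = 0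
  swap
  · have := isLetter_rot_neg htl
    rw [neg_zero] at this
    exact exists_isHamWord_of_coverPQ hpq (isLetter_ref hf) (isLetter_ref hg) this
      (neg_ne_zero.2 he) hb h2
  have h2p := two_ne_zero_of_odd (r := p) hp
  have haa : a' = a := by
    have : 2 * (a - a') = 0 := by linear_combination h1 + h2
    exact (sub_eq_zero.1 ((mul_eq_zero.1 this).resolve_left h2p)).symm
  subst haa
  have hr1 : ((r - 1 : ℕ) : ZMod p) = 0 := by
    have : 2 * (((r - 1 : ℕ) : ZMod p) * t) = 0 := by linear_combination h1
    simpa [h2p, ht0] using this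
  have hpr1 : p ≤ r - 1 := by
    rw [ZMod.natCast_eq_zero_iff] at hr1
    have : 2 ≤ r := two_le_of_fact
    exact Nat.le_of_dvd (by omega) hr1
  have hp1 : ((p - 1 : ℕ) : ZMod r) ≠ 0 := by
    rw [Ne, ZMod.natCast_eq_zero_iff]
    intro hd
    have : 2 ≤ p := two_le_of_fact
    have := Nat.le_of_dvd (by omega) hd
    omega
  refine (isCycleModR_ref_ref_rot (isLetter_ref hf) (isLetter_ref hg) htl ht0
    hb).exists_isHamWord ?_
  simpa [natCast_ne_zero_of_ne hqr, two_ne_zero_of_odd hr] using ⟨hp1, he⟩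

end DihZ

/-! ### Hamiltonian paths in the rotations modulo the subgroup of order `r` -/

namespace DihZ

variable {p q r : ℕ} {S : Set (DihZ p q r)}

lemma exists_visits_rot {w : List (DihZ p q r)} {x : DihZ p q r} {a : ZMod p} {b : ZMod q}
    (h : Visits w x) (h0 : ¬ isRef x) (h1 : fstC x = a) (h2 : sndC x = b) :
    ∃ c, Visits w (rot a b c) := by
  cases x with
  | rot a' b' c' => exact ⟨c', by simpa [← h1, ← h2] using h⟩
  | ref a' b' c' => simp at h0

variable [Fact p.Prime] [Fact q.Prime] [Fact r.Prime]

lemma isRotPath_replicate (hpq : p ≠ q) {a : ZMod p} {b : ZMod q} {c : ZMod r}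
    (ht : IsLetter S (rot a b c)) (ha : a ≠ 0) (hb : b ≠ 0) :
    IsRotPath S (((p * q - 1 : ℕ) : ZMod p) * a) (((p * q - 1 : ℕ) : ZMod q) * b)
      (((p * q - 1 : ℕ) : ZMod r) * c) (List.replicate (p * q - 1) (rot a b c)) where
  letter s hs := (List.eq_of_mem_replicate hs) ▸ ht
  cover x y := by
    obtain ⟨i, hi, hx, hy⟩ := exists_lt_mul_eq_mul_eq hpq ha hb x y
    have := visits_replicate (rot a b c) (by omega : i ≤ p * q - 1)
    rw [rot_pow, hx, hy] at this
    exact ⟨_, this⟩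
  prod_eq := by simp
  length_eq := by
    have : 0 < p * q := Nat.mul_pos (Fact.out : p.Prime).pos (Fact.out : q.Prime).pos
    simp; omega

/-- The rotations of order `p` are traversed one coset after the other. -/
lemma isRotPath_comb {a : ZMod p} {b : ZMod q} {c d : ZMod r}
    (ht : IsLetter S (rot a 0 c)) (hu : IsLetter S (rot 0 b d)) (ha : a ≠ 0) (hb : b ≠ 0) :
    IsRotPath S (((q : ZMod p)) * (((p - 1 : ℕ) : ZMod p) * a)) (((q - 1 : ℕ) : ZMod q) * b)
      ((q : ZMod r) * (((p - 1 : ℕ) : ZMod r) * c) + ((q - 1 : ℕ) : ZMod r) * d)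
      (wordPow (List.replicate (p - 1) (rot a 0 c) ++ [rot 0 b d]) (q - 1) ++
        List.replicate (p - 1) (rot a 0 c)) := by
  have hq : 2 ≤ q := two_le_of_fact
  have hp : 2 ≤ p := two_le_of_fact
  have hcast : ∀ n : ℕ, ((q - 1 : ℕ) : ZMod n) = q - 1 := fun n => by
    rw [Nat.cast_sub (by omega)]; simp
  refine ⟨?_, ?_, ?_, ?_⟩
  · intro s hs
    rcases List.mem_append.1 hs with hs | hs
    · have := mem_wordPow hs
      simp only [List.mem_append, List.mem_replicate, List.mem_singleton] at this
      rcases this with ⟨-, rfl⟩ | rfl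
      exacts [ht, hu]
    · exact (List.eq_of_mem_replicate hs) ▸ ht
  · intro x y
    obtain ⟨j, hj, hjy⟩ := exists_lt_mul_eq hb y
    -- Each completed block has shifted the `p`-coordinate by `(p - 1) * a`.
    obtain ⟨i, hi, hix⟩ := exists_lt_mul_eq ha (x - (j : ZMod p) * (((p - 1 : ℕ) : ZMod p) * a))
    have hv := visits_replicate (rot a 0 c : DihZ p q r) (by omega : i ≤ p - 1)
    rcases Nat.lt_or_ge j (q - 1) with hj' | hj'
    · have := ((hv.append_right [rot 0 b d]).wordPow hj').append_right
        (List.replicate (p - 1) (rot a 0 c))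
      refine exists_visits_rot this (by simp) ?_ ?_
      · simp [hix]
      · simp [hjy]
    · obtain rfl : j = q - 1 := by omega
      have := hv.append_left (wordPow (List.replicate (p - 1) (rot a 0 c) ++ [rot 0 b d]) (q - 1))
      refine exists_visits_rot this (by simp) ?_ ?_
      · simp [hix]
      · simp [hjy]
  · simp [hcast]
    refine ⟨?_, ?_⟩ <;> ring
  · simp
    obtain ⟨p', rfl⟩ := Nat.exists_eq_add_of_le' hp
    obtain ⟨q', rfl⟩ := Nat.exists_eq_add_of_le' hq
    simp; ring

/-- The last two of the cosets of the rotations of order `q` are traversed simultaneously. -/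
lemma isRotPath_hook {a : ZMod p} {b : ZMod q} {c d : ZMod r}
    (ht : IsLetter S (rot a 0 c)) (hu : IsLetter S (rot 0 b d)) (ha : a ≠ 0) (hb : b ≠ 0) :
    ∃ x y, IsRotPath S x y
      (((p - 2 : ℕ) : ZMod r) * (((q - 1 : ℕ) : ZMod r) * d + c) - d)
      (wordPow (List.replicate (q - 1) (rot 0 b d) ++ [rot a 0 c]) (p - 2) ++
        (List.replicate (q - 2) (rot 0 b d) ++ (rot a 0 c ::
          (List.replicate (q - 1) (rot (-0) (-b) (-d)) ++ [rot (-a) (-0) (-c)])))) := by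
  have hq : 2 ≤ q := two_le_of_fact
  have hp : 2 ≤ p := two_le_of_fact
  have hcast1 : ∀ n : ℕ, ((q - 1 : ℕ) : ZMod n) = q - 1 := fun n => by
    rw [Nat.cast_sub (by omega)]; simp
  have hcast2 : ∀ n : ℕ, ((q - 2 : ℕ) : ZMod n) = q - 2 := fun n => by
    rw [Nat.cast_sub (by omega)]; simp
  -- A block fills one coset and enters the next with `q`-coordinate shifted by `-b`. After `p - 2`
  -- blocks, the path leaves out one element of its coset, runs backwards through all of the last
  -- coset, and returns to the omitted element.
  set blk := List.replicate (q - 1) (rot 0 b d) ++ [rot a 0 c] with hblk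
  have hblkp : blk.prod = rot a (-b) (((q - 1 : ℕ) : ZMod r) * d + c) := by
    simp [hblk, hcast1]
  refine ⟨((p - 2 : ℕ) : ZMod p) * a, -((p - 2 : ℕ) : ZMod q) * b - b, ?_, ?_, ?_, ?_⟩
  · intro s hs
    rcases List.mem_append.1 hs with hs | hs
    · have := mem_wordPow hs
      simp only [hblk, List.mem_append, List.mem_replicate, List.mem_singleton] at this
      rcases this with ⟨-, rfl⟩ | rfl
      exacts [hu, ht]
    · simp only [List.mem_append, List.mem_replicate, List.mem_cons, List.not_mem_nil,
        or_false] at hs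
      rcases hs with ⟨-, rfl⟩ | rfl | ⟨-, rfl⟩ | rfl
      exacts [hu, ht, isLetter_rot_neg hu, isLetter_rot_neg ht]
  · intro x y
    obtain ⟨j, hj, hjx⟩ := exists_lt_mul_eq ha x
    rcases Nat.lt_or_ge j (p - 2) with hj' | hj'
    · obtain ⟨i, hi, hiy⟩ := exists_lt_mul_eq hb (y + (j : ZMod q) * b)
      have hv := visits_replicate (rot 0 b d : DihZ p q r) (by omega : i ≤ q - 1)
      have := ((hv.append_right [rot a 0 c]).wordPow hj').append_right
        (List.replicate (q - 2) (rot 0 b d) ++ (rot a 0 c ::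
          (List.replicate (q - 1) (rot (-0) (-b) (-d)) ++ [rot (-a) (-0) (-c)])))
      rw [← hblk, hblkp] at this
      refine exists_visits_rot this (by simp) ?_ ?_
      · simp [hjx]
      · simp [hiy]
    · rcases Nat.lt_or_ge (p - 2) j with hj'' | hj''
      · obtain rfl : j = (p - 2) + 1 := by omega
        obtain ⟨i, hi, hiy⟩ := exists_lt_mul_eq hb (-(((p - 2 : ℕ) : ZMod q) + 2) * b - y)
        have hv := visits_replicate (rot (-0) (-b) (-d) : DihZ p q r) (by omega : i ≤ q - 1)
        have := (((hv.append_right [rot (-a) (-0) (-c)]).cons (rot a 0 c)).append_left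
          (List.replicate (q - 2) (rot 0 b d))).append_left (wordPow blk (p - 2))
        rw [prod_wordPow, hblkp] at this
        refine exists_visits_rot this (by simp) ?_ ?_
        · simp [← hjx]; ring
        · simp [hiy, hcast2]; ring
      · obtain rfl : j = p - 2 := by omega
        obtain ⟨i, hi, hiy⟩ := exists_lt_mul_eq hb (y + ((p - 2 : ℕ) : ZMod q) * b)
        rcases Nat.lt_or_ge i (q - 1) with hi' | hi'
        · have hv := visits_replicate (rot 0 b d : DihZ p q r) (by omega : i ≤ q - 2)
          have := (hv.append_right (rot a 0 c ::
            (List.replicate (q - 1) (rot (-0) (-b) (-d)) ++ [rot (-a) (-0) (-c)]))).append_left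
              (wordPow blk (p - 2))
          rw [prod_wordPow, hblkp] at this
          refine exists_visits_rot this (by simp) ?_ ?_
          · simp [hjx]
          · simp [hiy]
        -- This is the omitted element, where the path ends.
        · obtain rfl : i = q - 1 := by omega
          refine ⟨((p - 2 : ℕ) : ZMod r) * (((q - 1 : ℕ) : ZMod r) * d + c) - d, ?_⟩
          convert Visits.prod _ using 1
          have hy : y = -((p - 2 : ℕ) : ZMod q) * b - b := by
            rw [hcast1] at hiy
            simp at hiy
            linear_combination -hiy
          simp [hblkp, hcast1, hcast2, hy, ← hjx]
          refine ⟨?_, ?_⟩ <;> ring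
  · simp [hblkp, hcast1, hcast2]
    refine ⟨?_, ?_⟩ <;> ring
  · simp [hblk]
    obtain ⟨p', rfl⟩ := Nat.exists_eq_add_of_le' hp
    obtain ⟨q', rfl⟩ := Nat.exists_eq_add_of_le' hq
    simp; ring

/-- If the comb fails with the first rotation and with its inverse, the difference of the products
forces `p = 1` modulo `r`. If the hook fails with the second rotation and with its inverse, the sum
forces `p = 2` modulo `r`. -/
lemma exists_isHamWord_ref_rot_rot_of_zero (hr : Odd r) (hqr : q ≠ r)
    {a a' : ZMod p} {b b' : ZMod q} {c d : ZMod r} (hf : ref a b 0 ∈ S)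
    (ht : rot a' 0 c ∈ S) (hu : rot 0 b' d ∈ S) (ha : a' ≠ 0) (hb : b' ≠ 0) (hc : c ≠ 0) :
    ∃ W, IsHamWord S W := by
  have hp3 : 2 ≤ p := two_le_of_fact
  have h2 := two_ne_zero_of_odd (r := r) hr
  have ht' := isLetter_rot ht (Or.inl ha)
  have hu' := isLetter_rot hu (Or.inr (Or.inl hb))
  have ht'' := isLetter_rot_neg ht'
  have hu'' := isLetter_rot_neg hu'
  rw [neg_zero] at ht'' hu''
  by_contra hcon
  have h1 := not_imp_comm.1
    ((isRotPath_comb ht' hu' ha hb).exists_isHamWord_of_ne_zero hr hf) hcon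
  have h1' := not_imp_comm.1
    ((isRotPath_comb ht'' hu' (neg_ne_zero.2 ha) hb).exists_isHamWord_of_ne_zero hr hf) hcon
  obtain ⟨x, y, hxy⟩ := isRotPath_hook ht' hu' ha hb
  obtain ⟨x', y', hxy'⟩ := isRotPath_hook ht' hu'' ha (neg_ne_zero.2 hb)
  have h3 := not_imp_comm.1 (hxy.exists_isHamWord_of_ne_zero hr hf) hcon
  have h3' := not_imp_comm.1 (hxy'.exists_isHamWord_of_ne_zero hr hf) hcon
  have e1 : 2 * ((q : ZMod r) * (((p - 1 : ℕ) : ZMod r) * c)) = 0 := by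
    linear_combination h1 - h1'
  have e2 : 2 * (((p - 2 : ℕ) : ZMod r) * c) = 0 := by linear_combination h3 + h3'
  have e1' : ((p - 1 : ℕ) : ZMod r) = 0 := by
    simpa [natCast_ne_zero_of_ne hqr, h2, hc] using e1
  have e2' : ((p - 2 : ℕ) : ZMod r) = 0 := by simpa [h2, hc] using e2
  have : ((p - 1 : ℕ) : ZMod r) = ((p - 2 : ℕ) : ZMod r) + 1 := by
    rw [show p - 1 = (p - 2) + 1 by omega]; push_cast; rfl
  rw [e1', e2'] at this
  simp at this

/-- Modulo the subgroup of order `r`, the second rotation is the `k`-th power of the first. In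
exponents of the first, the path is `0`, `k`, `k - 1`, ..., `1`, `k + 1`, ..., `pq - 1`. Both jumps
use the second rotation in the same direction, so its `r`-coordinate is counted twice. -/
lemma isRotPath_reversal (hpq : p ≠ q) {a a' : ZMod p} {b : ZMod q} {c : ZMod r}
    (ht : IsLetter S (rot a b 0)) (hu : IsLetter S (rot a' 0 c)) (ha : a ≠ 0) (hb : b ≠ 0)
    (ha' : a' ≠ 0) : ∃ x y w, IsRotPath S x y (2 * c) w := by
  obtain ⟨k, hk, hka, hkb⟩ := exists_lt_mul_eq_mul_eq hpq ha hb a' 0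
  have hk0 : k ≠ 0 := by rintro rfl; simp at hka; exact ha' hka.symm
  have hk1 : k + 1 ≠ p * q := by
    intro h
    have : ((k + 1 : ℕ) : ZMod q) = 0 := by rw [h]; simp
    push_cast at this
    apply hb
    linear_combination b * this - hkb
  obtain ⟨m, rfl⟩ := Nat.exists_eq_succ_of_ne_zero hk0
  obtain ⟨l, hl⟩ : ∃ l, p * q = m + 1 + 1 + l + 1 := ⟨p * q - (m + 3), by omega⟩
  push_cast at hka hkb
  refine ⟨2 * a' - m * a + l * a, - m * b + l * b, rot a' 0 c :: (List.replicate m (rot (-a) (-b) (-0)) ++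
    (rot a' 0 c :: List.replicate l (rot a b 0))), ?_, ?_, ?_, ?_⟩
  · intro s hs
    simp only [List.mem_append, List.mem_replicate, List.mem_cons] at hs
    rcases hs with rfl | ⟨-, rfl⟩ | rfl | ⟨-, rfl⟩
    exacts [hu, isLetter_rot_neg ht, hu, ht]
  · intro x y
    obtain ⟨i, hi, hx, hy⟩ := exists_lt_mul_eq_mul_eq hpq ha hb x y
    rcases Nat.eq_zero_or_pos i with rfl | hi0
    · refine ⟨0, ?_⟩
      convert Visits.one _ using 1
      simp [one_def, ← hx, ← hy]
    rcases Nat.lt_or_ge i (m + 2) with hi' | hi'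
    · obtain ⟨j, hj⟩ : ∃ j, i + j = m + 1 := ⟨m + 1 - i, by omega⟩
      have := ((visits_replicate (rot (-a) (-b) (-0) : DihZ p q r) (by omega : j ≤ m)).append_right
        (rot a' 0 c :: List.replicate l (rot a b 0))).cons (rot a' 0 c)
      have hjp : (i : ZMod p) + j = m + 1 := by exact_mod_cast congrArg (Nat.cast : ℕ → ZMod p) hj
      have hjq : (i : ZMod q) + j = m + 1 := by exact_mod_cast congrArg (Nat.cast : ℕ → ZMod q) hj
      refine exists_visits_rot this (by simp) ?_ ?_
      · simp
        linear_combination hx - hka - a * hjp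
      · simp
        linear_combination hy - hkb - b * hjq
    · obtain ⟨j, rfl⟩ := Nat.exists_eq_add_of_le hi'
      have := (((visits_replicate (rot a b 0 : DihZ p q r) (by omega : j ≤ l)).cons
        (rot a' 0 c)).append_left (List.replicate m (rot (-a) (-b) (-0)))).cons (rot a' 0 c)
      push_cast at hx hy
      refine exists_visits_rot this (by simp) ?_ ?_
      · simp
        linear_combination hx - 2 * hka
      · simp
        linear_combination hy - 2 * hkb
  · simp
    refine ⟨?_, ?_⟩ <;> ring
  · simp; omega

end DihZ

/-! ### Hamiltonian cycles in generalized Petersen graphs -/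

section Trails

variable {G : Type*} [Group G]

/-- There is a word of length `m` with letters in `L` that leads from `x` to `y` and passes through
all the elements of `V`. -/
def Trail (L : Set G) (x y : G) (m : ℕ) (V : Set G) : Prop :=
  ∃ w : List G, (∀ s ∈ w, s ∈ L) ∧ x * w.prod = y ∧ w.length = m ∧
    ∀ v ∈ V, ∃ u, Visits w u ∧ x * u = v

variable {L : Set G}

lemma Trail.trans {x y z : G} {m m' : ℕ} {V V' : Set G} (h : Trail L x y m V)
    (h' : Trail L y z m' V') : Trail L x z (m + m') (V ∪ V') := by
  obtain ⟨w, hw, rfl, rfl, hV⟩ := h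
  obtain ⟨w', hw', rfl, rfl, hV'⟩ := h'
  refine ⟨w ++ w', ?_, by simp [mul_assoc], by simp, ?_⟩
  · intro s hs
    rcases List.mem_append.1 hs with hs | hs
    exacts [hw s hs, hw' s hs]
  · rintro v (hv | hv)
    · obtain ⟨u, hu, rfl⟩ := hV v hv
      exact ⟨u, hu.append_right _, rfl⟩
    · obtain ⟨u, hu, rfl⟩ := hV' v hv
      exact ⟨_, hu.append_left w, by simp [mul_assoc]⟩

lemma Trail.single {x y s : G} (hs : s ∈ L) (h : x * s = y) : Trail L x y 1 ∅ :=
  ⟨[s], by simpa using hs, by simpa using h, rfl, by simp⟩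

lemma Trail.up (g : G) {s : G} (hs : s ∈ L) {i j : ℕ} {m : ℕ} (hij : i + m = j) :
    Trail L (g * s ^ i) (g * s ^ j) m {x | ∃ l, i ≤ l ∧ l ≤ j ∧ x = g * s ^ l} := by
  subst hij
  refine ⟨List.replicate m s, fun t ht => (List.eq_of_mem_replicate ht) ▸ hs, ?_, by simp, ?_⟩
  · rw [List.prod_replicate, mul_assoc, ← pow_add]
  · rintro v ⟨l, hl, hl', rfl⟩
    refine ⟨s ^ (l - i), visits_replicate s (by omega), ?_⟩
    rw [mul_assoc, ← pow_add]; congr; omega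

lemma Trail.down (g : G) {s : G} (hs : s⁻¹ ∈ L) {i j : ℕ} {m : ℕ} (hij : i + m = j) :
    Trail L (g * s ^ j) (g * s ^ i) m {x | ∃ l, i ≤ l ∧ l ≤ j ∧ x = g * s ^ l} := by
  have key : ∀ a b : ℕ, a ≤ b → s ^ b * s⁻¹ ^ (b - a) = s ^ a := by
    intro a b hab
    rw [inv_pow, mul_inv_eq_iff_eq_mul, ← pow_add]; congr; omega
  subst hij
  refine ⟨List.replicate m s⁻¹, fun t ht => (List.eq_of_mem_replicate ht) ▸ hs, ?_,
    by simp, ?_⟩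
  · rw [List.prod_replicate, mul_assoc]; convert congrArg (g * ·) (key i (i + m) (by omega)) using 4; omega
  · rintro v ⟨l, hl, hl', rfl⟩
    exact ⟨s⁻¹ ^ (i + m - l), visits_replicate _ (by omega), by rw [mul_assoc, key _ _ hl']⟩

/-- The hamiltonian cycle of `trail_of_mul_self_modEq_one` if `3 * k < n`. -/
theorem trail_of_three_mul_lt {n k : ℕ} {X Y : ℕ → G}
    (upX : ∀ i j m : ℕ, i + m = j → Trail L (X i) (X j) m {x | ∃ l, i ≤ l ∧ l ≤ j ∧ x = X l})
    (downX : ∀ j i m : ℕ, i + m = j → Trail L (X j) (X i) m {x | ∃ l, i ≤ l ∧ l ≤ j ∧ x = X l})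
    (upY : ∀ i j m : ℕ, i + m = j → Trail L (Y i) (Y j) m {x | ∃ l, i ≤ l ∧ l ≤ j ∧ x = Y l})
    (downY : ∀ j i m : ℕ, i + m = j → Trail L (Y j) (Y i) m {x | ∃ l, i ≤ l ∧ l ≤ j ∧ x = Y l})
    (spokeXY : ∀ a b i j : ℕ, i ≡ a + b * k [MOD n] → j ≡ b + a * k [MOD n] →
      Trail L (X i) (Y j) 1 ∅)
    (spokeYX : ∀ a b i j : ℕ, i ≡ a + b * k [MOD n] → j ≡ b + a * k [MOD n] →
      Trail L (Y j) (X i) 1 ∅)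
    (hG : ∀ g, ∃ i, 1 ≤ i ∧ i ≤ n ∧ (g = X i ∨ g = Y i)) (hk3 : 3 ≤ k) (h3 : 3 * k < n) :
    Trail L (X 1) (X 1) (2 * n) Set.univ := by
  have hn0 : n ≡ 0 + 0 * k [MOD n] := by simp [Nat.ModEq]
  have eqv : ∀ {a b : ℕ}, a = b → a ≡ b [MOD n] := fun h => h ▸ rfl
  -- Here `c = k - 3` and `d = n - 3k - 1` are run lengths. The cycle cuts each of the two rims into
  -- six intervals and joins the twelve runs by spokes from `a + b * k` to `b + a * k`; the index
  -- `n` stands for `0`.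
  obtain ⟨c, hc⟩ := Nat.exists_eq_add_of_le hk3
  obtain ⟨d, hd⟩ := Nat.exists_eq_add_of_lt h3
  have h := Trail.trans (upX (1) (2) (1) (by omega)) (
    Trail.trans (spokeXY 2 0 (2) (2 * k) (eqv (by ring)) (eqv (by ring))) (
    Trail.trans (downY (2 * k) (k + 3) (c) (by omega)) (
    Trail.trans (spokeYX 1 3 (3 * k + 1) (k + 3) (eqv (by ring)) (eqv (by ring))) (
    Trail.trans (upX (3 * k + 1) (n) (d) (by omega)) (
    Trail.trans (spokeXY 0 0 (n) (n) hn0 hn0) (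
    Trail.trans (downY (n) (3 * k + 1) (d) (by omega)) (
    Trail.trans (spokeYX 3 1 (k + 3) (3 * k + 1) (eqv (by ring)) (eqv (by ring))) (
    Trail.trans (upX (k + 3) (2 * k) (c) (by omega)) (
    Trail.trans (spokeXY 0 2 (2 * k) (2) (eqv (by ring)) (eqv (by ring))) (
    Trail.trans (downY (2) (1) (1) (by omega)) (
    Trail.trans (spokeYX 0 1 (k) (1) (eqv (by ring)) (eqv (by ring))) (
    Trail.trans (downX (k) (3) (c) (by omega)) (
    Trail.trans (spokeXY 3 0 (3) (3 * k) (eqv (by ring)) (eqv (by ring))) (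
    Trail.trans (downY (3 * k) (2 * k + 1) (c + 2) (by omega)) (
    Trail.trans (spokeYX 2 1 (k + 2) (2 * k + 1) (eqv (by ring)) (eqv (by ring))) (
    Trail.trans (downX (k + 2) (k + 1) (1) (by omega)) (
    Trail.trans (spokeXY 1 1 (k + 1) (k + 1) (eqv (by ring)) (eqv (by ring))) (
    Trail.trans (upY (k + 1) (k + 2) (1) (by omega)) (
    Trail.trans (spokeYX 1 2 (2 * k + 1) (k + 2) (eqv (by ring)) (eqv (by ring))) (
    Trail.trans (upX (2 * k + 1) (3 * k) (c + 2) (by omega)) (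
    Trail.trans (spokeXY 0 3 (3 * k) (3) (eqv (by ring)) (eqv (by ring))) (
    Trail.trans (upY (3) (k) (c) (by omega)) (
    (spokeYX 1 0 (1) (k) (eqv (by ring)) (eqv (by ring))))))))))))))))))))))))))
  obtain ⟨w, hw, hp, hw', hV⟩ := h
  refine ⟨w, hw, hp, hw'.trans (by linarith), fun g _ => hV g ?_⟩
  obtain ⟨i, hi1, hin, rfl | rfl⟩ := hG g
  · have hi : (1 ≤ i ∧ i ≤ 2) ∨ (3 * k + 1 ≤ i ∧ i ≤ n) ∨ (k + 3 ≤ i ∧ i ≤ 2 * k) ∨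
        (3 ≤ i ∧ i ≤ k) ∨ (k + 1 ≤ i ∧ i ≤ k + 2) ∨ (2 * k + 1 ≤ i ∧ i ≤ 3 * k) := by
      omega
    -- Runs and spokes alternate in the union, so the `X`-runs occupy positions `0, 4, ..., 20` and
    -- the `Y`-runs positions `2, 6, ..., 22`.
    rcases hi with hi | hi | hi | hi | hi | hi
    · exact Set.mem_union_left _ ⟨i, hi.1, hi.2, rfl⟩
    · iterate 4 apply Set.mem_union_right
      exact Set.mem_union_left _ ⟨i, hi.1, hi.2, rfl⟩
    · iterate 8 apply Set.mem_union_right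
      exact Set.mem_union_left _ ⟨i, hi.1, hi.2, rfl⟩
    · iterate 12 apply Set.mem_union_right
      exact Set.mem_union_left _ ⟨i, hi.1, hi.2, rfl⟩
    · iterate 16 apply Set.mem_union_right
      exact Set.mem_union_left _ ⟨i, hi.1, hi.2, rfl⟩
    · iterate 20 apply Set.mem_union_right
      exact Set.mem_union_left _ ⟨i, hi.1, hi.2, rfl⟩
  · have hi : (k + 3 ≤ i ∧ i ≤ 2 * k) ∨ (3 * k + 1 ≤ i ∧ i ≤ n) ∨ (1 ≤ i ∧ i ≤ 2) ∨
        (2 * k + 1 ≤ i ∧ i ≤ 3 * k) ∨ (k + 1 ≤ i ∧ i ≤ k + 2) ∨ (3 ≤ i ∧ i ≤ k) := by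
      omega
    rcases hi with hi | hi | hi | hi | hi | hi
    · iterate 2 apply Set.mem_union_right
      exact Set.mem_union_left _ ⟨i, hi.1, hi.2, rfl⟩
    · iterate 6 apply Set.mem_union_right
      exact Set.mem_union_left _ ⟨i, hi.1, hi.2, rfl⟩
    · iterate 10 apply Set.mem_union_right
      exact Set.mem_union_left _ ⟨i, hi.1, hi.2, rfl⟩
    · iterate 14 apply Set.mem_union_right
      exact Set.mem_union_left _ ⟨i, hi.1, hi.2, rfl⟩
    · iterate 18 apply Set.mem_union_right
      exact Set.mem_union_left _ ⟨i, hi.1, hi.2, rfl⟩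
    · iterate 22 apply Set.mem_union_right
      exact Set.mem_union_left _ ⟨i, hi.1, hi.2, rfl⟩

/-- The hamiltonian cycle of `trail_of_mul_self_modEq_one` if `n < 3 * k`. -/
theorem trail_of_lt_three_mul {n k : ℕ} {X Y : ℕ → G}
    (upX : ∀ i j m : ℕ, i + m = j → Trail L (X i) (X j) m {x | ∃ l, i ≤ l ∧ l ≤ j ∧ x = X l})
    (downX : ∀ j i m : ℕ, i + m = j → Trail L (X j) (X i) m {x | ∃ l, i ≤ l ∧ l ≤ j ∧ x = X l})
    (upY : ∀ i j m : ℕ, i + m = j → Trail L (Y i) (Y j) m {x | ∃ l, i ≤ l ∧ l ≤ j ∧ x = Y l})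
    (downY : ∀ j i m : ℕ, i + m = j → Trail L (Y j) (Y i) m {x | ∃ l, i ≤ l ∧ l ≤ j ∧ x = Y l})
    (spokeXY : ∀ a b i j : ℕ, i ≡ a + b * k [MOD n] → j ≡ b + a * k [MOD n] →
      Trail L (X i) (Y j) 1 ∅)
    (spokeYX : ∀ a b i j : ℕ, i ≡ a + b * k [MOD n] → j ≡ b + a * k [MOD n] →
      Trail L (Y j) (X i) 1 ∅)
    (hG : ∀ g, ∃ i, 1 ≤ i ∧ i ≤ n ∧ (g = X i ∨ g = Y i)) {e : ℕ}
    (hk3 : 3 ≤ k) (he : 3 * k = n + e) (he2 : 2 ≤ e)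
    (hk2 : 2 * k + 3 ≤ n) : Trail L (X 1) (X 1) (2 * n) Set.univ := by
  have hn0 : n ≡ 0 + 0 * k [MOD n] := by simp [Nat.ModEq]
  have eqv : ∀ {a b : ℕ}, a = b → a ≡ b [MOD n] := fun h => h ▸ rfl
  have eqe : ∀ {a b : ℕ}, a + n = b → a ≡ b [MOD n] := fun h => by simp [← h, Nat.ModEq]
  -- Now `3 * k` wraps around to `e`, and the run lengths are expressed by `c = k - 3`, `d = e - 2`,
  -- `g = k - e - 2` and `l = n - 2k - 3`.
  obtain ⟨c, hc⟩ := Nat.exists_eq_add_of_le hk3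
  obtain ⟨d, hd⟩ := Nat.exists_eq_add_of_le he2
  obtain ⟨g, hg⟩ := Nat.exists_eq_add_of_le (show e + 2 ≤ k by omega)
  obtain ⟨l, hl⟩ := Nat.exists_eq_add_of_le hk2
  have h := Trail.trans (upX (1) (2) (1) (by omega)) (
    Trail.trans (spokeXY 2 0 (2) (2 * k) (eqv (by ring)) (eqv (by ring))) (
    Trail.trans (downY (2 * k) (k + 3) (c) (by omega)) (
    Trail.trans (spokeYX 1 3 (e + 1) (k + 3) (eqe (by omega)) (eqv (by ring))) (
    Trail.trans (downX (e + 1) (3) (d) (by omega)) (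
    Trail.trans (spokeXY 3 0 (3) (e) (eqv (by ring)) (eqe (by omega))) (
    Trail.trans (downY (e) (1) (d + 1) (by omega)) (
    Trail.trans (spokeYX 0 1 (k) (1) (eqv (by ring)) (eqv (by ring))) (
    Trail.trans (downX (k) (e + 2) (g) (by omega)) (
    Trail.trans (spokeXY 2 3 (e + 2) (2 * k + 3) (eqe (by omega)) (eqv (by ring))) (
    Trail.trans (upY (2 * k + 3) (n) (l) (by omega)) (
    Trail.trans (spokeYX 0 0 (n) (n) hn0 hn0) (
    Trail.trans (downX (n) (2 * k + 2) (l + 1) (by omega)) (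
    Trail.trans (spokeXY 2 2 (2 * k + 2) (2 * k + 2) (eqv (by ring)) (eqv (by ring))) (
    Trail.trans (downY (2 * k + 2) (2 * k + 1) (1) (by omega)) (
    Trail.trans (spokeYX 2 1 (k + 2) (2 * k + 1) (eqv (by ring)) (eqv (by ring))) (
    Trail.trans (downX (k + 2) (k + 1) (1) (by omega)) (
    Trail.trans (spokeXY 1 1 (k + 1) (k + 1) (eqv (by ring)) (eqv (by ring))) (
    Trail.trans (upY (k + 1) (k + 2) (1) (by omega)) (
    Trail.trans (spokeYX 1 2 (2 * k + 1) (k + 2) (eqv (by ring)) (eqv (by ring))) (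
    Trail.trans (downX (2 * k + 1) (k + 3) (c + 1) (by omega)) (
    Trail.trans (spokeXY 3 1 (k + 3) (e + 1) (eqv (by ring)) (eqe (by omega))) (
    Trail.trans (upY (e + 1) (k) (g + 1) (by omega)) (
    (spokeYX 1 0 (1) (k) (eqv (by ring)) (eqv (by ring))))))))))))))))))))))))))
  obtain ⟨w, hw, hp, hw', hV⟩ := h
  refine ⟨w, hw, hp, hw'.trans (by linarith), fun g _ => hV g ?_⟩
  obtain ⟨i, hi1, hin, rfl | rfl⟩ := hG g
  · have hi : (1 ≤ i ∧ i ≤ 2) ∨ (3 ≤ i ∧ i ≤ e + 1) ∨ (e + 2 ≤ i ∧ i ≤ k) ∨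
        (2 * k + 2 ≤ i ∧ i ≤ n) ∨ (k + 1 ≤ i ∧ i ≤ k + 2) ∨ (k + 3 ≤ i ∧ i ≤ 2 * k + 1) := by
      omega
    rcases hi with hi | hi | hi | hi | hi | hi
    · exact Set.mem_union_left _ ⟨i, hi.1, hi.2, rfl⟩
    · iterate 4 apply Set.mem_union_right
      exact Set.mem_union_left _ ⟨i, hi.1, hi.2, rfl⟩
    · iterate 8 apply Set.mem_union_right
      exact Set.mem_union_left _ ⟨i, hi.1, hi.2, rfl⟩
    · iterate 12 apply Set.mem_union_right
      exact Set.mem_union_left _ ⟨i, hi.1, hi.2, rfl⟩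
    · iterate 16 apply Set.mem_union_right
      exact Set.mem_union_left _ ⟨i, hi.1, hi.2, rfl⟩
    · iterate 20 apply Set.mem_union_right
      exact Set.mem_union_left _ ⟨i, hi.1, hi.2, rfl⟩
  · have hi : (k + 3 ≤ i ∧ i ≤ 2 * k) ∨ (1 ≤ i ∧ i ≤ e) ∨ (2 * k + 3 ≤ i ∧ i ≤ n) ∨
        (2 * k + 1 ≤ i ∧ i ≤ 2 * k + 2) ∨ (k + 1 ≤ i ∧ i ≤ k + 2) ∨ (e + 1 ≤ i ∧ i ≤ k) := by
      omega
    rcases hi with hi | hi | hi | hi | hi | hi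
    · iterate 2 apply Set.mem_union_right
      exact Set.mem_union_left _ ⟨i, hi.1, hi.2, rfl⟩
    · iterate 6 apply Set.mem_union_right
      exact Set.mem_union_left _ ⟨i, hi.1, hi.2, rfl⟩
    · iterate 10 apply Set.mem_union_right
      exact Set.mem_union_left _ ⟨i, hi.1, hi.2, rfl⟩
    · iterate 14 apply Set.mem_union_right
      exact Set.mem_union_left _ ⟨i, hi.1, hi.2, rfl⟩
    · iterate 18 apply Set.mem_union_right
      exact Set.mem_union_left _ ⟨i, hi.1, hi.2, rfl⟩
    · iterate 22 apply Set.mem_union_right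
      exact Set.mem_union_left _ ⟨i, hi.1, hi.2, rfl⟩

/-- A hamiltonian cycle in the generalized Petersen graph with parameters `n` and `k`, if
`k ^ 2` is `1` modulo `n`. -/
theorem trail_of_mul_self_modEq_one {n k : ℕ} (hn : Odd n) (hk1 : 1 < k) (hkn : 2 * k < n)
    (hkk : k * k ≡ 1 [MOD n]) {t s f : G} (ht : t ∈ L) (ht' : t⁻¹ ∈ L) (hs : s ∈ L) (hs' : s⁻¹ ∈ L)
    (hf : f ∈ L) (hff : f * f = 1) (htn : t ^ n = 1) (hsn : s ^ n = 1) (htf : f * s ^ k = t * f)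
    (hG : ∀ g, ∃ i : ℕ, g = t ^ i ∨ g = f * s ^ i) : Trail L t t (2 * n) Set.univ := by
  set X : ℕ → G := fun i => 1 * t ^ i with hX
  set Y : ℕ → G := fun i => f * s ^ i with hY
  -- From `f * s ^ k = t * f` follows `t ^ i * f = f * s ^ (k * i)`.
  have spokeXY : ∀ i j : ℕ, k * i ≡ j [MOD n] → Trail L (X i) (Y j) 1 ∅ := by
    intro i j hij
    refine Trail.single hf ?_
    have h1 : f * (s ^ k) ^ i = t ^ i * f := (SemiconjBy.pow_right htf i)
    simp only [hX, hY, one_mul, ← h1, ← pow_mul]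
    rw [pow_eq_pow_mod _ hsn, hij, ← pow_eq_pow_mod _ hsn]
  have spokeYX : ∀ i j : ℕ, k * i ≡ j [MOD n] → Trail L (Y j) (X i) 1 ∅ := by
    intro i j hij
    obtain ⟨w, -, hw, hl, -⟩ := spokeXY i j hij
    refine Trail.single hf ?_
    have h1 : f * (s ^ k) ^ i = t ^ i * f := (SemiconjBy.pow_right htf i)
    have h2 : X i * f = Y j := by
      simp only [hX, hY, one_mul, ← h1, ← pow_mul]
      rw [pow_eq_pow_mod _ hsn, hij, ← pow_eq_pow_mod _ hsn]
    rw [← h2, mul_assoc, hff, mul_one]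
  have upX : ∀ i j m : ℕ, i + m = j → Trail L (X i) (X j) m {x | ∃ l, i ≤ l ∧ l ≤ j ∧ x = X l} :=
    fun i j m h => Trail.up 1 ht h
  have downX : ∀ j i m : ℕ, i + m = j → Trail L (X j) (X i) m {x | ∃ l, i ≤ l ∧ l ≤ j ∧ x = X l} :=
    fun j i m h => Trail.down 1 ht' h
  have upY : ∀ i j m : ℕ, i + m = j → Trail L (Y i) (Y j) m {x | ∃ l, i ≤ l ∧ l ≤ j ∧ x = Y l} :=
    fun i j m h => Trail.up f hs h
  have downY : ∀ j i m : ℕ, i + m = j → Trail L (Y j) (Y i) m {x | ∃ l, i ≤ l ∧ l ≤ j ∧ x = Y l} :=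
    fun j i m h => Trail.down f hs' h
  have key : ∀ a b i j : ℕ, i ≡ a + b * k [MOD n] → j ≡ b + a * k [MOD n] →
      k * i ≡ j [MOD n] := by
    intro a b i j hi hj
    calc k * i ≡ k * (a + b * k) [MOD n] := hi.mul_left k
      _ = a * k + b * (k * k) := by ring
      _ ≡ a * k + b * 1 [MOD n] := (hkk.mul_left b).add_left _
      _ = b + a * k := by ring
      _ ≡ j [MOD n] := hj.symm
  have hG' : ∀ g, ∃ i, 1 ≤ i ∧ i ≤ n ∧ (g = X i ∨ g = Y i) := by
    intro g
    have hmod : ∀ i : ℕ, ∃ j, 1 ≤ j ∧ j ≤ n ∧ ∀ u : G, u ^ n = 1 → u ^ i = u ^ j := by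
      intro i
      rcases Nat.eq_zero_or_pos (i % n) with h0 | h0
      · refine ⟨n, by omega, le_rfl, fun u hu => ?_⟩
        rw [pow_eq_pow_mod _ hu, h0, pow_zero, hu]
      · exact ⟨i % n, h0, (Nat.mod_lt _ (by omega)).le, fun u hu => pow_eq_pow_mod _ hu⟩
    obtain ⟨i, hi⟩ := hG g
    obtain ⟨j, hj1, hj2, hj⟩ := hmod i
    refine ⟨j, hj1, hj2, ?_⟩
    rcases hi with rfl | rfl
    · exact Or.inl (by simp [hX, hj t htn])
    · exact Or.inr (by simp [hY, hj s hsn])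
  have hX1 : X 1 = t := by simp [hX]
  obtain ⟨m, hm⟩ : (n : ℤ) ∣ k * k - 1 := by
    have := (Nat.modEq_iff_dvd.1 hkk.symm)
    push_cast at this
    exact this
  -- For `k = 2`, `n` would divide `k ^ 2 - 1 = 3`.
  have hk3 : 3 ≤ k := by
    by_contra h
    obtain rfl : k = 2 := by omega
    have : (n : ℤ) ∣ 3 := ⟨m, by push_cast at hm; linarith⟩
    have := Int.le_of_dvd (by norm_num) this
    omega
  rw [← hX1]
  rcases lt_trichotomy (3 * k) n with h3 | h3 | h3
  · exact trail_of_three_mul_lt upX downX upY downY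
      (fun a b i j hi hj => spokeXY i j (key a b i j hi hj))
      (fun a b i j hi hj => spokeYX i j (key a b i j hi hj)) hG' hk3 h3
  · exfalso
    have : (k : ℤ) ∣ 1 := ⟨k - 3 * m, by subst h3; push_cast at hm; linarith⟩
    have := Int.le_of_dvd (by norm_num) this
    omega
  · obtain ⟨e, he⟩ := Nat.exists_eq_add_of_le h3.le
    -- If `3k = n + 1`, squaring gives `9 = 1` modulo `n`, so the odd `n` would divide `8`.
    have he2 : 2 ≤ e := by
      by_contra h
      obtain rfl : e = 1 := by omega
      have h3k : (3 : ℤ) * k = n + 1 := by exact_mod_cast he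
      have : (n : ℤ) ∣ 8 := ⟨n + 2 - 9 * m, by
        linear_combination (3 * k + n + 1) * h3k - 9 * hm⟩
      have h8 : n ∣ 2 ^ 3 := by exact_mod_cast this
      have := (Nat.Coprime.pow_right 3 (Nat.coprime_two_right.2 hn)).eq_one_of_dvd h8
      omega
    -- As `n` is odd, the only alternative is `2k = n - 1`; squaring gives `4 = 1` modulo `n`.
    have hk2 : 2 * k + 3 ≤ n := by
      by_contra h
      obtain ⟨a, ha⟩ := hn
      have h2k : (2 : ℤ) * k = n - 1 := by
        have : 2 * k + 1 = n := by omega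
        rw [← this]; push_cast; ring
      have : (n : ℤ) ∣ 3 := ⟨n - 2 - 4 * m, by
        linear_combination (2 * k + n - 1) * h2k - 4 * hm⟩
      have := Int.le_of_dvd (by norm_num) this
      omega
    exact trail_of_lt_three_mul upX downX upY downY
      (fun a b i j hi hj => spokeXY i j (key a b i j hi hj))
      (fun a b i j hi hj => spokeYX i j (key a b i j hi hj)) hG' hk3 he he2 hk2

end Trails

/-! ### Case analysis on the connection set, and reduction from connectedness -/

namespace DihZ

variable {p q r : ℕ} {S : Set (DihZ p q r)} [Fact p.Prime] [Fact q.Prime] [Fact r.Prime]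

/-! #### A rotation of order `pqr` -/

lemma exists_mul_eq_mul_eq_mul_eq (hpq : p ≠ q) (hpr : p ≠ r) (hqr : q ≠ r) {a : ZMod p}
    {b : ZMod q} {c : ZMod r} (ha : a ≠ 0) (hb : b ≠ 0) (hc : c ≠ 0) (x : ZMod p) (y : ZMod q)
    (z : ZMod r) :
    ∃ i < p * q * r, (i : ZMod p) * a = x ∧ (i : ZMod q) * b = y ∧ (i : ZMod r) * c = z := by
  obtain ⟨i, -, hi, hi'⟩ := exists_lt_mul_eq_mul_eq hpq ha hb x y
  obtain ⟨j, -, hj⟩ := exists_lt_mul_eq hc z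
  have hp : p.Prime := Fact.out
  have hq : q.Prime := Fact.out
  have hr : r.Prime := Fact.out
  have hco : (p * q).Coprime r :=
    Nat.Coprime.mul_left ((Nat.coprime_primes hp hr).2 hpr) ((Nat.coprime_primes hq hr).2 hqr)
  have h := (Nat.chineseRemainder hco i j).2
  refine ⟨Nat.chineseRemainder hco i j, Nat.chineseRemainder_lt_mul hco _ _
    (Nat.mul_ne_zero hp.ne_zero hq.ne_zero) hr.ne_zero, ?_, ?_, ?_⟩
  · rw [(ZMod.natCast_eq_natCast_iff _ _ _).2 (h.1.of_mul_right q), hi]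
  · rw [(ZMod.natCast_eq_natCast_iff _ _ _).2 (h.1.of_mul_left p), hi']
  · rw [(ZMod.natCast_eq_natCast_iff _ _ _).2 h.2, hj]

lemma exists_isHamWord_of_petersen (hp2 : Odd p) (hq2 : Odd q) (hr2 : Odd r) (hpq : p ≠ q)
    (hpr : p ≠ r) (hqr : q ≠ r) {x a a' : ZMod p} {y b b' : ZMod q} {c c' : ZMod r}
    (hf : ref x y 0 ∈ S) (ht : IsLetter S (rot a b c)) (hs : IsLetter S (rot a' b' c'))
    (ha : a ≠ 0) (hb : b ≠ 0) (hc : c ≠ 0) (ha' : a' ≠ 0) (hb' : b' ≠ 0) (hc' : c' ≠ 0) {k : ℕ}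
    (hk1 : 1 < k) (hkn : 2 * k < p * q * r) (hkk : k * k ≡ 1 [MOD p * q * r])
    (hka : (k : ZMod p) * a' = -a) (hkb : (k : ZMod q) * b' = -b) (hkc : (k : ZMod r) * c' = c) :
    ∃ W, IsHamWord S W := by
  have hcov : ∀ g : DihZ p q r, ∃ i : ℕ,
      g = rot a b c ^ i ∨ g = ref x y 0 * rot a' b' c' ^ i := by
    rintro (⟨u, v, w⟩ | ⟨u, v, w⟩)
    · obtain ⟨i, -, h1, h2, h3⟩ := exists_mul_eq_mul_eq_mul_eq hpq hpr hqr ha hb hc u v w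
      exact ⟨i, Or.inl (by simp [h1, h2, h3])⟩
    · obtain ⟨i, -, h1, h2, h3⟩ :=
        exists_mul_eq_mul_eq_mul_eq hpq hpr hqr ha' hb' hc' (x - u) (y - v) w
      exact ⟨i, Or.inr (by simp [h1, h2, h3])⟩
  obtain ⟨W, hW, hprod, hlen, hvis⟩ := trail_of_mul_self_modEq_one (L := {s | IsLetter S s})
    ((hp2.mul hq2).mul hr2) hk1 hkn hkk (t := rot a b c) (s := rot a' b' c') (f := ref x y 0)
    ht ht.inv hs hs.inv (isLetter_ref hf) (by simp) (by simp) (by simp)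
    (by simp [hka, hkb, hkc, add_comm]) hcov
  refine ⟨W, hW, by simpa using hprod, fun g => ?_, by rw [hlen, card_eq]; ring⟩
  -- The trail starts at `rot a b c` rather than at `1`, so it is translated back on the left.
  obtain ⟨u, hu, h⟩ := hvis (rot a b c * g) (Set.mem_univ _)
  exact mul_left_cancel h ▸ hu

/-- Conjugation by the reflection sends the rotation to its `k`-th power, where `k` is `-1` modulo
`p` and `q` and `1` modulo `r`; thus `k ^ 2 = 1` modulo `pqr`. If `2k > pqr`, then `pqr - k` and the
inverse rotation serve on the inner rim. -/
lemma exists_isHamWord_ref_rot_of_zero (hp2 : Odd p) (hq2 : Odd q) (hr2 : Odd r) (hpq : p ≠ q)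
    (hpr : p ≠ r) (hqr : q ≠ r) {x a : ZMod p} {y b : ZMod q} {c : ZMod r} (hf : ref x y 0 ∈ S)
    (ht : rot a b c ∈ S) (ha : a ≠ 0) (hb : b ≠ 0) (hc : c ≠ 0) : ∃ W, IsHamWord S W := by
  have htl := isLetter_rot ht (Or.inl ha)
  obtain ⟨k, hk, hka, hkb, hkc⟩ :=
    exists_mul_eq_mul_eq_mul_eq hpq hpr hqr ha hb hc (-a) (-b) c
  have hp : p.Prime := Fact.out
  have hq : q.Prime := Fact.out
  have hr : r.Prime := Fact.out
  have hkp : (k : ZMod p) = -1 := mul_right_cancel₀ ha (by rw [hka]; ring)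
  have hkq : (k : ZMod q) = -1 := mul_right_cancel₀ hb (by rw [hkb]; ring)
  have hkr : (k : ZMod r) = 1 := mul_right_cancel₀ hc (by rw [hkc]; ring)
  have hmod : ∀ {l : ℕ}, (l : ZMod p) * l = 1 → (l : ZMod q) * l = 1 → (l : ZMod r) * l = 1 →
      l * l ≡ 1 [MOD p * q * r] := by
    intro l h1 h2 h3
    have hco : (p * q).Coprime r :=
      Nat.Coprime.mul_left ((Nat.coprime_primes hp hr).2 hpr) ((Nat.coprime_primes hq hr).2 hqr)
    refine (Nat.modEq_and_modEq_iff_modEq_mul hco).1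
      ⟨(Nat.modEq_and_modEq_iff_modEq_mul ((Nat.coprime_primes hp hq).2 hpq)).1 ⟨?_, ?_⟩, ?_⟩
    all_goals rw [← ZMod.natCast_eq_natCast_iff]; push_cast; assumption
  have hn : Odd (p * q * r) := (hp2.mul hq2).mul hr2
  have h2p := two_ne_zero_of_odd (r := p) hp2
  have h2r := two_ne_zero_of_odd (r := r) hr2
  have hk1 : 1 < k := by
    rcases Nat.lt_or_ge 1 k with h | h
    · exact h
    · exfalso
      interval_cases k
      · simp at hkr
      · apply h2p
        push_cast at hkp
        linear_combination hkp
  obtain ⟨l, hl⟩ := Nat.exists_eq_add_of_lt hk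
  have hcast : ∀ {m : ℕ}, m ∣ p * q * r → ((l + 1 : ℕ) : ZMod m) = -(k : ZMod m) := by
    intro m hm
    have : ((k + l + 1 : ℕ) : ZMod m) = 0 := by
      rw [← hl]; exact (ZMod.natCast_eq_zero_iff _ _).2 hm
    push_cast at this ⊢
    linear_combination this
  have hlp := hcast (m := p) ⟨q * r, by ring⟩
  have hlq := hcast (m := q) ⟨p * r, by ring⟩
  have hlr := hcast (m := r) ⟨p * q, by ring⟩
  rcases Nat.lt_or_ge (2 * k) (p * q * r) with h | h
  · exact exists_isHamWord_of_petersen hp2 hq2 hr2 hpq hpr hqr hf htl htl ha hb hc ha hb hc hk1 h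
      (hmod (by simp [hkp]) (by simp [hkq]) (by simp [hkr])) hka hkb hkc
  · obtain ⟨m, hm⟩ := hn
    have hl0 : l ≠ 0 := by
      rintro rfl
      apply h2r
      push_cast at hlr
      linear_combination hlr - hkr
    refine exists_isHamWord_of_petersen hp2 hq2 hr2 hpq hpr hqr hf htl (isLetter_rot_neg htl)
      ha hb hc (neg_ne_zero.2 ha) (neg_ne_zero.2 hb) (neg_ne_zero.2 hc) (k := l + 1) (by omega)
      (by omega) (hmod ?_ ?_ ?_) ?_ ?_ ?_ <;> simp only [hlp, hlq, hlr, hkp, hkq, hkr] <;> ring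

/-! #### The general case -/

lemma exists_isHamWord_of_swap (h : ∃ W, IsHamWord (swap (p := q) (q := p) (r := r) ⁻¹' S) W) :
    ∃ W, IsHamWord S W :=
  h.imp' _ fun _ hW => hW.map swap

/-- The elements that generate, together with a reflection with coordinate `a`, a subgroup of order
divisible by `p`. -/
def MovesFst (a : ZMod p) : DihZ p q r → Prop
  | rot a' _ _ => a' ≠ 0
  | ref a' _ _ => a' ≠ a

/-- The elements that generate, together with a reflection with coordinate `b`, a subgroup of order
divisible by `q`. -/
def MovesSnd (b : ZMod q) : DihZ p q r → Prop
  | rot _ b' _ => b' ≠ 0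
  | ref _ b' _ => b' ≠ b

lemma exists_isHamWord_of_ne_zero (hr2 : Odd r) (hpq : p ≠ q) (hpr : p ≠ r) (hqr : q ≠ r)
    {a : ZMod p} {b : ZMod q} {c : ZMod r} (hf : ref a b c ∈ S)
    (hc : c ≠ 0 ∨ ∃ z ≠ 0, rot 0 0 z ∈ S)
    (h1 : ∃ s ∈ S, MovesFst a s) (h2 : ∃ s ∈ S, MovesSnd b s) : ∃ W, IsHamWord S W := by
  have both : ∀ s ∈ S, MovesFst a s → MovesSnd b s → ∃ W, IsHamWord S W := by
    rintro (⟨a', b', c'⟩ | ⟨a', b', c'⟩) hs ha hb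
    · exact (isRotPath_replicate hpq (isLetter_rot hs (Or.inl ha)) ha hb).exists_isHamWord hr2 hf hc
    · exact exists_isHamWord_ref_ref hr2 hpq hpr hqr hf hs (Ne.symm ha) (Ne.symm hb) hc
  obtain ⟨s, hs, hsa⟩ := h1
  obtain ⟨u, hu, hub⟩ := h2
  by_cases hsb : MovesSnd b s
  · exact both s hs hsa hsb
  by_cases hua : MovesFst a u
  · exact both u hu hua hub
  -- Neither letter moves both coordinates now, so `s` moves only the first and `u` only the second.
  rcases s with ⟨a', b', c'⟩ | ⟨a', b', c'⟩ <;> rcases u with ⟨x, y, z⟩ | ⟨x, y, z⟩ <;>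
    simp only [MovesFst, MovesSnd, not_not] at hsa hsb hua hub <;> subst hsb hua
  · exact (isRotPath_comb (isLetter_rot hs (Or.inl hsa)) (isLetter_rot hu (Or.inr (Or.inl hub)))
      hsa hub).exists_isHamWord hr2 hf hc
  · exact exists_isHamWord_ref_ref_rot hr2 hqr hf hu hs hsa hub hc
  · exact exists_isHamWord_of_swap (exists_isHamWord_ref_ref_rot (S := swap ⁻¹' S) hr2 hpr
      hf hs hu hub hsa hc)
  · exact exists_isHamWord_ref_ref_ref hr2 hqr hf hs hu hsa hub hc

lemma exists_isHamWord_of_rot (hp2 : Odd p) (hq2 : Odd q) (hr2 : Odd r) (hpq : p ≠ q)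
    (hpr : p ≠ r) (hqr : q ≠ r) {a t : ZMod p} {b : ZMod q} {c : ZMod r} (hf : ref a b 0 ∈ S)
    (hS : ∀ a b c, ref a b c ∈ S → c = 0) (ht : rot t 0 c ∈ S) (ht0 : t ≠ 0) (hc : c ≠ 0)
    (h2 : ∃ s ∈ S, MovesSnd b s) : ∃ W, IsHamWord S W := by
  obtain ⟨⟨a', b', c'⟩ | ⟨a', b', c'⟩, hs, hb'⟩ := h2 <;> simp only [MovesSnd] at hb'
  · by_cases ha' : a' = 0
    · subst ha'
      exact exists_isHamWord_ref_rot_rot_of_zero hr2 hqr hf ht hs ht0 hb' hc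
    by_cases hc' : c' = 0
    · subst hc'
      obtain ⟨x, y, w, hw⟩ := isRotPath_reversal hpq (isLetter_rot hs (Or.inl ha'))
        (isLetter_rot ht (Or.inl ht0)) ha' hb' ht0
      exact hw.exists_isHamWord_of_ne_zero hr2 hf (mul_ne_zero (two_ne_zero_of_odd hr2) hc)
    · exact exists_isHamWord_ref_rot_of_zero hp2 hq2 hr2 hpq hpr hqr hf hs ha' hb' hc'
  · obtain rfl := hS _ _ _ hs
    exact exists_isHamWord_ref_ref_rot_of_zero hp2 hr2 hpq hqr hf hs ht ht0 hc hb'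

lemma exists_isHamWord (hp2 : Odd p) (hq2 : Odd q) (hr2 : Odd r) (hpq : p ≠ q)
    (hpr : p ≠ r) (hqr : q ≠ r) (h0 : ∃ s ∈ S, isRef s) (h1 : ∀ a, ∃ s ∈ S, MovesFst a s)
    (h2 : ∀ b, ∃ s ∈ S, MovesSnd b s) (h3 : ∃ s ∈ S, trdC s ≠ 0) : ∃ W, IsHamWord S W := by
  by_cases hS : ∀ a b c, ref a b c ∈ S → c = 0
  swap
  · push Not at hS
    obtain ⟨a, b, c, hf, hc⟩ := hS
    exact exists_isHamWord_of_ne_zero hr2 hpq hpr hqr hf (Or.inl hc) (h1 a) (h2 b)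
  obtain ⟨⟨_, _, _⟩ | ⟨a, b, c⟩, hf, h⟩ := h0
  · exact h.elim
  obtain rfl := hS _ _ _ hf
  obtain ⟨⟨x, y, z⟩ | ⟨x, y, z⟩, ht, hz⟩ := h3 <;> simp only [trdC_rot, trdC_ref] at hz
  swap
  · exact absurd (hS _ _ _ ht) hz
  by_cases hx : x = 0 <;> by_cases hy : y = 0
  · subst hx hy
    exact exists_isHamWord_of_ne_zero hr2 hpq hpr hqr hf (Or.inr ⟨z, hz, ht⟩) (h1 a) (h2 b)
  · subst hx
    refine exists_isHamWord_of_swap (exists_isHamWord_of_rot (S := swap ⁻¹' S) hq2 hp2 hr2 hpq.symm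
      hqr hpr (a := b) (b := a) hf (fun a b c h => hS _ _ _ h) ht hy hz ?_)
    obtain ⟨s, hs, hsa⟩ := h1 a
    refine ⟨swap s, by cases s <;> exact hs, by cases s <;> exact hsa⟩
  · subst hy
    exact exists_isHamWord_of_rot hp2 hq2 hr2 hpq hpr hqr hf hS ht hx hz (h2 b)
  · exact exists_isHamWord_ref_rot_of_zero hp2 hq2 hr2 hpq hpr hqr hf ht hx hy hz

/-- A subset of a group isomorphic to `DihZ p q r` with connected Cayley graph is not contained in
the proper subgroups that preserve `P`. -/
lemma exists_mem_of_connected {G : Type*} [Group G] {T : Set G}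
    (hT : (SimpleGraph.mulCayley T).Connected) (e : DihZ p q r ≃* G) {P Q : DihZ p q r → Prop}
    (h1 : P 1) (hP : ∃ g, ¬ P g) (hQ : ∀ s, ¬ Q s → ∀ g, P g ↔ P (g * s)) :
    ∃ s ∈ e ⁻¹' T, Q s := by
  by_contra! h
  obtain ⟨g, hg⟩ := hP
  apply hg
  have := mulCayley_connected_induction hT (P := fun g => P (e.symm g)) (by simpa using h1)
    (fun g s hs => by simpa using hQ (e.symm s) (h _ (by simpa using hs)) (e.symm g)) (e g)
  simpa using this

lemma exists_isHamWord_of_connected {G : Type*} [Group G] {T : Set G}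
    (hT : (SimpleGraph.mulCayley T).Connected) (e : DihZ p q r ≃* G) (hp2 : Odd p) (hq2 : Odd q)
    (hr2 : Odd r) (hpq : p ≠ q) (hpr : p ≠ r) (hqr : q ≠ r) : ∃ W, IsHamWord T W := by
  have h : ∃ W, IsHamWord (e ⁻¹' T) W := by
    -- The four conditions say that `S` lies neither in the rotations, nor in the subgroup of order
    -- `2qr` whose reflections have `p`-coordinate `a`, nor in its analogue for `q`, nor in the
    -- dihedral factor.
    refine exists_isHamWord hp2 hq2 hr2 hpq hpr hqr ?_ (fun a => ?_) (fun b => ?_) ?_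
    · refine exists_mem_of_connected hT e (P := fun g => ¬ isRef g) (by simp [one_def])
        ⟨ref 0 0 0, by simp⟩ ?_
      rintro (_ | _) hs (_ | _) <;> simp_all
    · refine exists_mem_of_connected hT e
        (P := fun g => (isRef g → fstC g = a) ∧ (¬ isRef g → fstC g = 0))
        (by simp [one_def]) ⟨rot 1 0 0, by simp⟩ ?_
      rintro (_ | _) hs (_ | _) <;> simp_all [MovesFst, sub_eq_zero]
    · refine exists_mem_of_connected hT e
        (P := fun g => (isRef g → sndC g = b) ∧ (¬ isRef g → sndC g = 0))
        (by simp [one_def]) ⟨rot 0 1 0, by simp⟩ ?_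
      rintro (_ | _) hs (_ | _) <;> simp_all [MovesSnd, sub_eq_zero]
    · refine exists_mem_of_connected hT e (P := fun g => trdC g = 0)
        (by simp [one_def]) ⟨rot 0 0 1, by simp⟩ ?_
      rintro (_ | _) hs (_ | _) <;> simp_all
  exact h.imp' _ fun _ hW => hW.map e

end DihZ

theorem mainTheorem2 (p q r : ℕ) (hp : p.Prime) (hq : q.Prime) (hr : r.Prime)
    (hp_odd : Odd p) (hq_odd : Odd q) (hr_odd : Odd r)
    (hpq : p ≠ q) (hpr : p ≠ r) (hqr : q ≠ r)
    (G : Type*) [Group G] [DecidableEq G]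
    (hG : Nonempty (G ≃* DihedralGroup (p * q) × Multiplicative (ZMod r)))
    (S : Set G) (hS : (SimpleGraph.mulCayley S).Connected) :
    ∃ (v : G) (C : (SimpleGraph.mulCayley S).Walk v v), C.IsHamiltonianCycle := by
  obtain ⟨e⟩ := hG
  have := Fact.mk hp
  have := Fact.mk hq
  have := Fact.mk hr
  let e' : DihZ p q r ≃* G := (e.trans (DihZ.ofProd ((Nat.coprime_primes hp hq).2 hpq))).symm
  obtain ⟨W, hW⟩ := DihZ.exists_isHamWord_of_connected hS e' hp_odd hq_odd hr_odd hpq hpr hqr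
  have := Finite.of_equiv _ e'.toEquiv
  refine hW.exists_isHamiltonianCycle ?_
  rw [← Nat.card_congr e'.toEquiv, DihZ.card_eq]
  have : 0 < q * r := Nat.mul_pos hq.pos hr.pos
  nlinarith [hp.two_le]
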